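/- **Setting.** There are two groups of workers, each of mass one with skills $x_1,x_2\in[0,1]$, and a mass one of firms with project values $z\in[0,1]$. All three populations have the same type distribution, a probability measure on $[0,1]$ with a density $f$ that is continuous on $(0,1)$ and a distribution function $F$ that is strictly increasing on $[0,1]$. Let $I:[0,1]\to[0,1]$ be the inverse of $F$. A firm $z$ with workers $x_1,x_2$ produces $y(x_1,x_2,z)=(1-x_1x_2)z$. An equilibrium consists of functions $w,v:[0,1]\to\mathbb R$ (wage schedule, firm value) and a probability measure $\pi$ on $[0,1]^3$ all of whose marginals are $F$, such that for all $x_1,x_2,z\in[0,1]$ $$v(z)=\max_{x_1',x_2'}\big(y(x_1',x_2',z)-w(x_1')-w(x_2')\big),$$ $$w(x_1)=\max_{x_2',z'}\big(y(x_1,x_2',z')-w(x_2')-v(z')\big),$$ $$w(x_2)=\max_{x_1',z'}\big(y(x_1',x_2,z')-w(x_1')-v(z')\big)$$ (maxima over $[0,1]^2$, attained), and $\int y\,d\pi=2\int w\,dF+\int v\,dF$. For $q\in(0,\tfrac13)$ put $\mathcal C(q)=\exp\Big(\frac1{1/3-q}\int_q^{1-2q}\log I(p)\,dp\Big)$. Let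 $\underline p\in(0,\tfrac13]$ be a lower percentile bound, that is, either $\underline p<\tfrac13$ and $\mathcal C(\underline p)=I(1-2\underline p)^2\,I(\underline p)$, or $\underline p=\tfrac13$ and this equation has no solution in $(0,\tfrac13)$. (Such a $\underline p$ always exists.) Put $\bar p=1-2\underline p$ and, when $\underline p<\tfrac13$, $\mathcal C=\mathcal C(\underline p)$. Assume that (a) $xf(x)$ is nondecreasing on $[I(\underline p),I(\bar p)]$; (b) $L(p)=2\log I(1-2p)+\log I(p)$ is concave on $[0,\tfrac13]$ (where $L(0)=-\infty$). For $x\in[0,1]$ and $p=F(x)$ define $$m(x)=\begin{cases}-I(1-2p)^2 & \text{if } p\in[0,\underline p],\\ -\mathcal C/I(p) & \text{if } p\in(\underline p,\bar p),\\ -I(p)\,I\big(\tfrac{1-p}2\big) & \text{if } p\in[\bar p,1],\end{cases}$$ where the third line is used for $p>\underline p$ if $\underline p=\bar p=\tfrac13$ (at $p=\tfrac13$ the two lines agree). **Proposition (Wages).** The function $m$ is integrable on $[0,1]$, and a function $w:[0,1]\to\mathbb R$ is the wage schedule of some equilibrium if and only if there is a constant $\mathcal C_w\in\mathbb R$ such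 that $$w(x)=\mathcal C_w+\int_0^x m(s)\,ds\qquad\text{for all }x\in[0,1].$$ In particular an equilibrium exists, and the equilibrium wage schedule is unique up to the additive constant $\mathcal C_w$. -/

import Mathlib

open MeasureTheory ProbabilityTheory Set

noncomputable section

namespace TeamSorting

/-- The type space `X = Z = [0,1]`, both for worker skills and for project values. -/
def types : Set ℝ := Icc 0 1

/-- Output `y(x₁,x₂,z) = (1 - x₁ x₂) z`. -/
def output (x₁ x₂ z : ℝ) : ℝ := (1 - x₁ * x₂) * z

/-- `μ` is a type distribution on `[0,1]` with density `f`, continuous on `(0,1)`,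
and its distribution function is strictly increasing on `[0,1]`. -/
structure IsTypeDistribution (μ : Measure ℝ) (f : ℝ → ℝ) : Prop where
  prob : IsProbabilityMeasure μ
  density_nonneg : ∀ x ∈ Ioo (0 : ℝ) 1, 0 ≤ f x
  density_continuous : ContinuousOn f (Ioo 0 1)
  eq_withDensity :
    μ = (volume.restrict (Icc 0 1)).withDensity (fun x => ENNReal.ofReal (f x))
  cdf_strictMono : StrictMonoOn (cdf μ) (Icc 0 1)

/-- The inverse distribution function: `quantile μ p` is the `x ∈ [0,1]` with `F(x) = p`
(used only for `p ∈ [0,1]`, where such an `x` exists and is unique). -/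
def quantile (μ : Measure ℝ) (p : ℝ) : ℝ := Function.invFunOn (cdf μ) (Icc 0 1) p

/-- Feasible assignments `Π(F_x, F_x, F_z)`. -/
structure IsFeasible (μx μz : Measure ℝ) (π : Measure (ℝ × ℝ × ℝ)) : Prop where
  prob : IsProbabilityMeasure π
  map_worker : π.map (fun t => t.1) = μx
  map_coworker : π.map (fun t => t.2.1) = μx
  map_firm : π.map (fun t => t.2.2) = μz

/-- An equilibrium: wage schedule `w`, firm value function `v` and assignment `π`.
The values of `w` and `v` outside `[0,1]` play no role. The optimality conditions make `w` and
`v` Lipschitz on `[0,1]`, so that all integrals in `resource` are those of integrable functions. -/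
structure IsEquilibrium (μx μz : Measure ℝ) (w v : ℝ → ℝ) (π : Measure (ℝ × ℝ × ℝ)) :
    Prop where
  feasible : IsFeasible μx μz π
  firm : ∀ z ∈ types, IsGreatest
    ((fun q : ℝ × ℝ => output q.1 q.2 z - w q.1 - w q.2) '' (types ×ˢ types)) (v z)
  worker : ∀ x₁ ∈ types, IsGreatest
    ((fun q : ℝ × ℝ => output x₁ q.1 q.2 - w q.1 - v q.2) '' (types ×ˢ types)) (w x₁)
  coworker : ∀ x₂ ∈ types, IsGreatest
    ((fun q : ℝ × ℝ => output q.1 x₂ q.2 - w q.1 - v q.2) '' (types ×ˢ types)) (w x₂)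
  resource : ∫ t, output t.1 t.2.1 t.2.2 ∂π
    = ∫ x, w x ∂μx + ∫ x, w x ∂μx + ∫ z, v z ∂μz

/-- `w` is an equilibrium wage schedule. -/
def IsEquilibriumWage (μx μz : Measure ℝ) (w : ℝ → ℝ) : Prop :=
  ∃ (v : ℝ → ℝ) (π : Measure (ℝ × ℝ × ℝ)), IsEquilibrium μx μz w v π

/-- The loss constant `C` on the completely mixed set with lower percentile bound `pl < 1/3`
and upper percentile bound `1 - 2 pl`. -/
def lossConstant (μ : Measure ℝ) (pl : ℝ) : ℝ :=
  Real.exp (1 / (1 / 3 - pl) * ∫ p in pl..(1 - 2 * pl), Real.log (quantile μ p))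

/-- The equation `C = I(1 - 2 pl)² I(pl)` for the lower percentile bound. -/
def CutoffEquation (μ : Measure ℝ) (pl : ℝ) : Prop :=
  lossConstant μ pl = quantile μ (1 - 2 * pl) ^ 2 * quantile μ pl

/-- `pl ∈ (0, 1/3]` is a lower percentile bound: it solves the cutoff equation. As `pl → 1/3` both
sides of the equation tend to `I(1/3)³` whatever the distribution is, so `pl = 1/3` (no mixed
middle) is the bound exactly when no smaller solution exists. -/
def IsLowerCutoff (μ : Measure ℝ) (pl : ℝ) : Prop :=
  (pl ∈ Ioo (0 : ℝ) (1 / 3) ∧ CutoffEquation μ pl) ∨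
    (pl = 1 / 3 ∧ ∀ q ∈ Ioo (0 : ℝ) (1 / 3), ¬ CutoffEquation μ q)

theorem exists_isLowerCutoff (μ : Measure ℝ) : ∃ pl, IsLowerCutoff μ pl := by
  by_cases h : ∃ q ∈ Ioo (0 : ℝ) (1 / 3), CutoffEquation μ q
  · obtain ⟨q, hq, he⟩ := h
    exact ⟨q, Or.inl ⟨hq, he⟩⟩
  · exact ⟨1 / 3, Or.inr ⟨rfl, fun q hq he => h ⟨q, hq, he⟩⟩⟩

/-- Logarithmic loss `L(p) = 2 log I(1 - 2p) + log I(p)`. -/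
def logLoss (μ : Measure ℝ) (p : ℝ) : ℝ :=
  2 * Real.log (quantile μ (1 - 2 * p)) + Real.log (quantile μ p)

/-- The marginal product `m(x)` of a worker with skill `x = I(p)`, that is `p = F(x)`. -/
def marginalProduct (μ : Measure ℝ) (pl x : ℝ) : ℝ :=
  if cdf μ x ≤ pl then -(quantile μ (1 - 2 * cdf μ x)) ^ 2
  else if cdf μ x < 1 - 2 * pl then -(lossConstant μ pl / quantile μ (cdf μ x))
  else -(quantile μ (cdf μ x) * quantile μ ((1 - cdf μ x) / 2))

end TeamSorting

end

/-!
Output is `z - x₁ x₂ z`, so an efficient assignment minimizes the expected loss `E[x₁ x₂ z]` over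
couplings of three copies of the type distribution, and equilibrium prices are the solutions of the
dual problem. Write `g` for minus the marginal product, `Φ(x) = ∫₀ˣ g`, and call a team
`(x₁, x₂, x₃)` critical if the product of any two of its types is `g` of the third
(`criticalTeams`).

*Dual side.* Concavity of the logarithmic loss `L` and the cutoff equation, which says that `L` at
the cutoff is the mean of `L` up to `1/3`, make `L` nondecreasing up to the cutoff
(`logLoss_monotoneOn`). This gives `g` a simple shape, recorded in `MatchingCurve`. The slack
`x₁ x₂ x₃ - Φ(x₁) - Φ(x₂) - Φ(x₃)` attains its minimum over the cube at a critical team. All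
critical teams have the same slack (`slack_criticalTeams`): along the teams
`(I(p), I(1-2p), I(1-2p))` it has derivative zero, and on teams of maximal loss `Φ` is logarithmic.
So, up to a constant, `Φ` is dual feasible and tight on critical teams (`slack_ge`).

*Primal side.* There is a feasible assignment to critical teams. By the Riesz extension and
representation theorems (`exists_coupling_of_integral_nonneg`) it suffices that `∫ α dμ ≥ 0`
whenever the sums of `α` over critical teams are nonnegative. The matched percentiles contribute
`α(I(p)) + 2 α(I(1-2p)) ≥ 0`. On the middle percentiles, in the variable `u = log (b / x)`, this
is the dual form of the joint mixability of three copies of a decreasing density with extremal mean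
(`integral_mul_nonneg_of_simplex`): after adding to `α` a multiple of `u - c/3`, all its integrals
over initial intervals are nonnegative (`exists_tilt`), and a decreasing density is a mixture of
uniform densities on initial intervals.

*Wages.* The two sides together give the equilibrium. Conversely, in any equilibrium the optimal
assignment above makes every type `x` belong to a critical team in which it is paid for exactly
(`exists_tight_criticalTeam`). Hence `w(x') ≥ w(x) - (x' - x) g(x)` for all `x, x'`, and as `g` is
continuous, `w' = -g`.
-/

namespace TeamSorting

/-! ### Mixing a decreasing density over a simplex -/

/-- A down-closed subset of `(0, c]` is an initial interval up to a null set. -/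
theorem setIntegral_nonneg_of_isInitial {c : ℝ} {ψ : ℝ → ℝ}
    (hprim : ∀ t ∈ Icc 0 c, 0 ≤ ∫ u in (0 : ℝ)..t, ψ u) {A : Set ℝ} (hA : A ⊆ Ioc 0 c)
    (hdown : ∀ u ∈ A, Ioc 0 u ⊆ A) : 0 ≤ ∫ u in A, ψ u := by
  rcases A.eq_empty_or_nonempty with rfl | hne
  · simp
  have hbdd : BddAbove A := ⟨c, fun u hu => (hA hu).2⟩
  have hle : ∀ u ∈ A, u ≤ sSup A := fun u hu => le_csSup hbdd hu
  obtain ⟨u₀, hu₀⟩ := hne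
  have h0 : 0 ≤ sSup A := (hA hu₀).1.le.trans (hle _ hu₀)
  have hsc : sSup A ≤ c := csSup_le ⟨u₀, hu₀⟩ fun u hu => (hA hu).2
  have hsub : A ⊆ Ioc 0 (sSup A) := fun u hu => ⟨(hA hu).1, hle u hu⟩
  have hsup : Ioo 0 (sSup A) ⊆ A := fun u hu => by
    obtain ⟨u', hu', hlt⟩ := exists_lt_of_lt_csSup ⟨u₀, hu₀⟩ hu.2
    exact hdown u' hu' ⟨hu.1, hlt.le⟩
  have hae : A =ᵐ[volume] Ioc 0 (sSup A) :=
    (LE.le.eventuallyLE hsub).antisymm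
      (Ioo_ae_eq_Ioc.symm.le.trans (LE.le.eventuallyLE hsup))
  rw [setIntegral_congr_set hae, ← intervalIntegral.integral_of_le h0]
  exact hprim _ ⟨h0, hsc⟩

/-- Layer-cake form of the second mean value theorem: an antitone weight is a positive mixture of
indicators of initial intervals. -/
theorem integral_mul_nonneg_of_antitoneOn {c : ℝ} (hc : 0 ≤ c) {ψ κ : ℝ → ℝ} (hψ : Continuous ψ)
    (hκ : AntitoneOn κ (Icc 0 c)) (hκ0 : ∀ u ∈ Icc 0 c, 0 ≤ κ u)
    (hprim : ∀ t ∈ Icc 0 c, 0 ≤ ∫ u in (0 : ℝ)..t, ψ u) :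
    0 ≤ ∫ u in (0 : ℝ)..c, ψ u * κ u := by
  set k : ℝ → ℝ := fun u => κ (projIcc 0 c hc u) with hk
  have hkanti : Antitone k := fun u v huv =>
    hκ (projIcc 0 c hc u).2 (projIcc 0 c hc v).2 (monotone_projIcc hc huv)
  have hkm : Measurable k := hkanti.measurable
  have hkeq : ∀ u ∈ Ioc 0 c, κ u = k u := fun u hu => by
    simp only [hk]; rw [projIcc_of_mem hc (Ioc_subset_Icc_self hu)]
  have hk0 : ∀ u, 0 ≤ k u := fun u => hκ0 _ (projIcc 0 c hc u).2
  have hkK : ∀ u ∈ Ioc 0 c, k u ≤ k 0 := fun u hu => hkanti hu.1.le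
  set K := k 0
  -- the integrand of the layer-cake formula
  set J : ℝ → ℝ → ℝ := fun u y => (Iic (k u)).indicator (fun _ => ψ u) y with hJ
  have hlayer : ∀ u ∈ Ioc 0 c, ψ u * κ u = ∫ y in Ioc 0 K, J u y := by
    intro u hu
    have : Ioc 0 K ∩ Iic (k u) = Ioc 0 (k u) := by
      ext y; simp only [mem_inter_iff, mem_Ioc, mem_Iic]
      exact ⟨fun h => ⟨h.1.1, h.2⟩, fun h => ⟨⟨h.1, h.2.trans (hkK u hu)⟩, h.2⟩⟩
    rw [hJ, setIntegral_indicator measurableSet_Iic, this, hkeq u hu]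
    simp [hk0 u, mul_comm]
  rw [intervalIntegral.integral_of_le hc, setIntegral_congr_fun measurableSet_Ioc hlayer]
  have hmeas : Measurable (Function.uncurry J) := by
    have : Function.uncurry J = {p : ℝ × ℝ | p.2 ≤ k p.1}.indicator (fun p => ψ p.1) := by
      ext ⟨u, y⟩; simp [hJ, indicator]
    rw [this]
    exact (hψ.measurable.comp measurable_fst).indicator
      (measurableSet_le measurable_snd (hkm.comp measurable_fst))
  obtain ⟨B, hB⟩ := isCompact_Icc.exists_bound_of_continuousOn (s := Icc 0 c) hψ.continuousOn
  have hint : Integrable (Function.uncurry J)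
      ((volume.restrict (Ioc 0 c)).prod (volume.restrict (Ioc 0 K))) := by
    refine Integrable.of_bound hmeas.aestronglyMeasurable B ?_
    rw [Measure.prod_restrict]
    refine (ae_restrict_iff' (measurableSet_Ioc.prod measurableSet_Ioc)).2 (.of_forall ?_)
    rintro ⟨u, y⟩ ⟨hu, -⟩
    exact (norm_indicator_le_norm_self (fun _ => ψ u) y).trans (hB u (Ioc_subset_Icc_self hu))
  rw [integral_integral_swap hint]
  refine integral_nonneg fun y => ?_
  have hset : MeasurableSet {u | y ≤ k u} := measurableSet_le measurable_const hkm
  have : ∀ u, J u y = {u | y ≤ k u}.indicator ψ u := fun u => by simp [hJ, indicator]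
  simp only [Pi.zero_apply, this]
  rw [setIntegral_indicator hset]
  exact setIntegral_nonneg_of_isInitial hprim inter_subset_left
    fun u hu v hv => ⟨⟨hv.1, hv.2.trans hu.1.2⟩, hu.2.trans (hkanti hv.2)⟩

/-- The mean of `α` over the segment from `p` to `q`, written so that it makes sense
for `p = q`. -/
noncomputable def segMean (α : ℝ → ℝ) (p q : ℝ) : ℝ := ∫ ρ in (0 : ℝ)..1, α (p + ρ * (q - p))

theorem segMean_mul (α : ℝ → ℝ) (p q : ℝ) :
    (q - p) * segMean α p q = ∫ u in p..q, α u := by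
  have := intervalIntegral.mul_integral_comp_add_mul (f := α) (a := 0) (b := 1) (q - p) p
  simp only [segMean, mul_comm _ (q - p)]
  rw [this]; simp

theorem segMean_self (α : ℝ → ℝ) (p : ℝ) : segMean α p p = α p := by simp [segMean]

theorem segMean_add_nonneg {α : ℝ → ℝ} (hα : Continuous α) {c : ℝ}
    (h : ∀ u₁ u₂ u₃ : ℝ, 0 ≤ u₁ → 0 ≤ u₂ → 0 ≤ u₃ → u₁ + u₂ + u₃ = c →
      0 ≤ α u₁ + α u₂ + α u₃)
    {p₁ p₂ p₃ q₁ q₂ q₃ : ℝ} (hp₁ : 0 ≤ p₁) (hp₂ : 0 ≤ p₂) (hp₃ : 0 ≤ p₃)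
    (hq₁ : 0 ≤ q₁) (hq₂ : 0 ≤ q₂) (hq₃ : 0 ≤ q₃) (hp : p₁ + p₂ + p₃ = c)
    (hq : q₁ + q₂ + q₃ = c) :
    0 ≤ segMean α p₁ q₁ + segMean α p₂ q₂ + segMean α p₃ q₃ := by
  have hi : ∀ p q : ℝ, IntervalIntegrable (fun ρ : ℝ => α (p + ρ * (q - p))) volume 0 1 :=
    fun p q => Continuous.intervalIntegrable (by fun_prop) _ _
  unfold segMean
  rw [← intervalIntegral.integral_add (hi _ _) (hi _ _),
    ← intervalIntegral.integral_add ((hi _ _).add (hi _ _)) (hi _ _)]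
  refine intervalIntegral.integral_nonneg zero_le_one fun ρ hρ => ?_
  have hconv : ∀ p q : ℝ, 0 ≤ p → 0 ≤ q → 0 ≤ p + ρ * (q - p) := fun p q hp hq => by
    nlinarith [mul_nonneg hρ.1 hq, mul_nonneg (sub_nonneg.2 hρ.2) hp]
  exact h _ _ _ (hconv _ _ hp₁ hq₁) (hconv _ _ hp₂ hq₂) (hconv _ _ hp₃ hq₃)
    (by linear_combination (1 - ρ) * hp + ρ * hq)

/-- If the smallest initial mean `m` of `α` is attained at both `s ≤ 2c/3` and `t ≥ 2c/3`,
then `m ≥ 0`. Each case integrates the hypothesis along a segment of the simplex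
`u₁ + u₂ + u₃ = c` chosen so that the density of the three coordinates drops only at `s` and
at `t`, where the primitive `P` of `α - m` vanishes while it is nonnegative elsewhere (in the first
case one coordinate is constant, equal to `s`). -/
theorem min_segMean_nonneg {c : ℝ} {α : ℝ → ℝ} (hα : Continuous α)
    (h : ∀ u₁ u₂ u₃ : ℝ, 0 ≤ u₁ → 0 ≤ u₂ → 0 ≤ u₃ → u₁ + u₂ + u₃ = c →
      0 ≤ α u₁ + α u₂ + α u₃)
    {s t m : ℝ} (hs : s ∈ Icc 0 (2 * c / 3)) (ht : t ∈ Icc (2 * c / 3) c) (hc : 0 < c)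
    (hms : segMean α 0 s = m) (hmt : segMean α 0 t = m)
    (hm : ∀ r ∈ Icc 0 c, m ≤ segMean α 0 r) : 0 ≤ m := by
  set P : ℝ → ℝ := fun r => (∫ u in (0 : ℝ)..r, α u) - m * r with hP
  have hPmean : ∀ r, P r = r * (segMean α 0 r - m) := fun r => by
    have := segMean_mul α 0 r
    simp only [hP, ← this]; ring
  have hP0 : ∀ r ∈ Icc 0 c, 0 ≤ P r := fun r hr => by
    rw [hPmean]; exact mul_nonneg hr.1 (sub_nonneg.2 (hm r hr))
  have hPs : P s = 0 := by rw [hPmean, hms]; ring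
  have hPt : P t = 0 := by rw [hPmean, hmt]; ring
  have hdiff : ∀ p q, (q - p) * (segMean α p q - m) = P q - P p := fun p q => by
    have h1 := segMean_mul α p q
    have h2 := intervalIntegral.integral_interval_sub_left
      (hα.intervalIntegrable (μ := volume) 0 q) (hα.intervalIntegrable 0 p)
    simp only [hP]; rw [mul_sub, h1, ← h2]; ring
  have hmean_le : ∀ p q, p < q → P q = 0 → p ∈ Icc 0 c → segMean α p q ≤ m := by
    intro p q hpq hq hp
    have h1 := hdiff p q
    have h2 := hP0 p hp
    by_contra! hlt
    nlinarith [mul_pos (sub_pos.2 hpq) (sub_pos.2 hlt)]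
  obtain ⟨hs0, hs1⟩ := hs
  obtain ⟨ht0, ht1⟩ := ht
  rcases le_or_gt (s + t) c with hst | hst
  · -- the segment `(s, y, c - s - y)` with `c - s - t ≤ y ≤ t`
    -- at `s = 0` the mean is `α 0` itself, and at `s > 0` the primitive `P` has an interior minimum
    have hαs : α s = m := by
      rcases hs0.eq_or_lt with rfl | hspos
      · rw [← hms, segMean_self]
      have hder : HasDerivAt P (α s - m) s := by
        have := (intervalIntegral.integral_hasDerivAt_right (hα.intervalIntegrable 0 s)
          (hα.stronglyMeasurableAtFilter _ _) hα.continuousAt).fun_sub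
          ((hasDerivAt_id s).const_mul m)
        simpa [hP] using this
      have hmin : IsLocalMin P s := by
        filter_upwards [Ioo_mem_nhds hspos (show s < c by linarith)] with r hr
        rw [hPs]; exact hP0 r ⟨hr.1.le, hr.2.le⟩
      linarith [hmin.hasDerivAt_eq_zero hder]
    have key := segMean_add_nonneg hα h (p₁ := s) (p₂ := c - s - t) (p₃ := t) (q₁ := s) (q₂ := t)
      (q₃ := c - s - t) hs0 (by linarith) (by linarith) hs0 (by linarith) (by linarith)
      (by ring) (by ring)
    have h1 : segMean α (c - s - t) t ≤ m :=
      hmean_le _ _ (by linarith) hPt ⟨by linarith, by linarith⟩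
    have h2 : segMean α t (c - s - t) ≤ m := by
      have e1 := hdiff t (c - s - t)
      have e2 := hP0 (c - s - t) ⟨by linarith, by linarith⟩
      by_contra! hlt
      nlinarith [mul_pos (show 0 < t - (c - s - t) by linarith) (sub_pos.2 hlt)]
    rw [segMean_self, hαs] at key
    linarith
  rcases lt_or_ge (c / 2) s with hs2 | hs2
  · -- the segment from `(0, c - s, s)` to `(c - s, s, 0)`
    have key := segMean_add_nonneg hα h (p₁ := 0) (p₂ := c - s) (p₃ := s) (q₁ := c - s) (q₂ := s)
      (q₃ := 0) le_rfl (by linarith) (by linarith) (by linarith) (by linarith) le_rfl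
      (by ring) (by ring)
    have h3 : segMean α s 0 = m := by
      have e1 := hdiff s 0
      have e2 : P 0 = 0 := by simp [hP]
      rw [e2, hPs] at e1
      have : (0 - s) ≠ 0 := by linarith
      linarith [(mul_eq_zero.1 (e1.trans (sub_zero 0))).resolve_left this]
    have h1 := hdiff 0 (c - s)
    have h2 := hdiff (c - s) s
    have hp := hP0 (c - s) ⟨by linarith, by linarith⟩
    rw [show P 0 = 0 by simp [hP]] at h1
    rw [hPs] at h2
    set X := segMean α 0 (c - s) - m
    set Y := segMean α (c - s) s - m
    have hX : 0 ≤ X := by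
      by_contra! hlt
      nlinarith
    -- `2 s - c ≤ c - s` makes the drop at `c - s` harmless
    have hXY : X + Y ≤ 0 := by
      by_contra! hlt
      nlinarith [mul_pos (show 0 < s - (c - s) by linarith) hlt]
    have : segMean α 0 (c - s) + segMean α (c - s) s ≤ 2 * m := by
      simp only [X, Y] at hXY; linarith
    linarith
  · -- the segment from `(c - t, t, 0)` to `(s, c - 2 s, s)`
    have key := segMean_add_nonneg hα h (p₁ := c - t) (p₂ := t) (p₃ := 0) (q₁ := s)
      (q₂ := c - 2 * s) (q₃ := s) (by linarith) (by linarith) le_rfl (by linarith) (by linarith)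
      hs0 (by ring) (by ring)
    have h1 : segMean α (c - t) s ≤ m :=
      hmean_le _ _ (by linarith) hPs ⟨by linarith, by linarith⟩
    have h2 : segMean α t (c - 2 * s) ≤ m := by
      have e1 := hdiff t (c - 2 * s)
      have e2 := hP0 (c - 2 * s) ⟨by linarith, by linarith⟩
      by_contra! hlt
      nlinarith [mul_pos (show 0 < t - (c - 2 * s) by linarith) (sub_pos.2 hlt)]
    linarith

/-- Tilting by a multiple of `u - c / 3` leaves the sums over the simplex unchanged; the right
multiple balances the minimal initial means on both sides of `2c/3`. -/
theorem exists_tilt {c : ℝ} (hc : 0 < c) {β : ℝ → ℝ} (hβ : Continuous β)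
    (h : ∀ u₁ u₂ u₃ : ℝ, 0 ≤ u₁ → 0 ≤ u₂ → 0 ≤ u₃ → u₁ + u₂ + u₃ = c →
      0 ≤ β u₁ + β u₂ + β u₃) :
    ∃ θ : ℝ, ∀ t ∈ Icc 0 c, 0 ≤ ∫ u in (0 : ℝ)..t, (β u - θ * (u - c / 3)) := by
  set A : ℝ → ℝ := segMean β 0 with hA
  have hAc : Continuous A := by
    simp only [hA]
    exact intervalIntegral.continuous_parametric_intervalIntegral_of_continuous'
      (by simp only [Function.uncurry_def]; fun_prop) 0 1
  -- `T θ t` is the mean over `[0, t]` of the function tilted by `θ`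
  set T : ℝ → ℝ → ℝ := fun θ t => A t - θ * (t / 2 - c / 3) with hT
  have hTc : Continuous (Function.uncurry T) := by
    simp only [hT, Function.uncurry_def]; fun_prop
  have hTθ : ∀ θ, Continuous (T θ) := fun θ => by simp only [hT]; fun_prop
  have hTmean : ∀ θ t, segMean (fun u => β u - θ * (u - c / 3)) 0 t = T θ t := by
    intro θ t
    have e1 : IntervalIntegrable (fun ρ : ℝ => β (0 + ρ * (t - 0))) volume 0 1 :=
      Continuous.intervalIntegrable (by fun_prop) _ _
    have e2 : IntervalIntegrable (fun ρ : ℝ => θ * (0 + ρ * (t - 0) - c / 3)) volume 0 1 :=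
      Continuous.intervalIntegrable (by fun_prop) _ _
    have e3 : IntervalIntegrable (fun ρ : ℝ => (0 + ρ * (t - 0))) volume 0 1 :=
      Continuous.intervalIntegrable (by fun_prop) _ _
    have e4 : IntervalIntegrable (fun _ : ℝ => c / 3) volume 0 1 :=
      Continuous.intervalIntegrable (by fun_prop) _ _
    simp only [segMean, hT, hA]
    rw [intervalIntegral.integral_sub e1 e2, intervalIntegral.integral_const_mul,
      intervalIntegral.integral_sub e3 e4]
    simp [integral_id]
    left; ring
  set τ := 2 * c / 3 with hτ
  have hl : (Icc 0 τ).Nonempty := ⟨0, le_rfl, by positivity⟩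
  have hr : (Icc τ c).Nonempty := ⟨c, by rw [hτ]; linarith, le_rfl⟩
  set Q : ℝ → ℝ := fun θ => sInf (T θ '' Icc 0 τ) - sInf (T θ '' Icc τ c) with hQ
  have hQc : Continuous Q :=
    (isCompact_Icc.continuous_sInf hTc).sub (isCompact_Icc.continuous_sInf hTc)
  have hbdd : ∀ θ a b, BddBelow (T θ '' Icc a b) := fun θ a b =>
    (isCompact_Icc.image (hTθ θ)).bddBelow
  obtain ⟨B, hB⟩ := isCompact_Icc.exists_bound_of_continuousOn (s := Icc 0 c) hAc.continuousOn
  have hBn : 0 ≤ B := (norm_nonneg _).trans (hB 0 ⟨le_rfl, hc.le⟩)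
  have hB1 : ∀ t ∈ Icc 0 c, -B ≤ A t ∧ A t ≤ B := fun t ht => abs_le.1 (hB t ht)
  have hτc : τ ≤ c := by rw [hτ]; linarith
  have hτ0 : 0 < τ := by positivity
  -- with `|A| ≤ B`, these tilts push the mean at `t = c`, respectively at `t = 0`, down to `-B`,
  -- and raise the means on the other side of `τ`
  have hpos : 0 ≤ Q (12 * B / c) := by
    have h1 : sInf (T (12 * B / c) '' Icc τ c) ≤ -B := by
      refine (csInf_le (hbdd _ _ _) (mem_image_of_mem _ (⟨hτc, le_rfl⟩ : c ∈ Icc τ c))).trans ?_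
      have : T (12 * B / c) c = A c - 2 * B := by simp only [hT]; field_simp; ring
      linarith [(hB1 c ⟨hc.le, le_rfl⟩).2]
    have h2 : -B ≤ sInf (T (12 * B / c) '' Icc 0 τ) := by
      refine le_csInf (hl.image _) ?_
      rintro _ ⟨t, ht, rfl⟩
      have h3 : 0 ≤ (12 * B / c) * (c / 3 - t / 2) :=
        mul_nonneg (by positivity) (by have := ht.2; rw [hτ] at this; linarith)
      have := (hB1 t ⟨ht.1, ht.2.trans hτc⟩).1
      simp only [hT]; linarith
    simp only [hQ]; linarith
  have hneg : Q (-(6 * B / c)) ≤ 0 := by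
    have h1 : sInf (T (-(6 * B / c)) '' Icc 0 τ) ≤ -B := by
      refine (csInf_le (hbdd _ _ _) (mem_image_of_mem _ (⟨le_rfl, hτ0.le⟩ : 0 ∈ Icc 0 τ))).trans ?_
      have : T (-(6 * B / c)) 0 = A 0 - 2 * B := by simp only [hT]; field_simp; ring
      linarith [(hB1 0 ⟨le_rfl, hc.le⟩).2]
    have h2 : -B ≤ sInf (T (-(6 * B / c)) '' Icc τ c) := by
      refine le_csInf (hr.image _) ?_
      rintro _ ⟨t, ht, rfl⟩
      have h3 : 0 ≤ (6 * B / c) * (t / 2 - c / 3) :=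
        mul_nonneg (by positivity) (by have := ht.1; rw [hτ] at this; linarith)
      have := (hB1 t ⟨hτ0.le.trans ht.1, ht.2⟩).1
      simp only [hT]; linarith
    simp only [hQ]; linarith
  obtain ⟨θ, -, hθ⟩ := intermediate_value_uIcc hQc.continuousOn
    (mem_uIcc.2 (Or.inl ⟨hneg, hpos⟩))
  refine ⟨θ, ?_⟩
  obtain ⟨s, hs, hsm⟩ := isCompact_Icc.exists_sInf_image_eq hl (hTθ θ).continuousOn
  obtain ⟨t, ht, htm⟩ := isCompact_Icc.exists_sInf_image_eq hr (hTθ θ).continuousOn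
  have hst : T θ t = T θ s := by rw [← hsm, ← htm]; simp only [hQ] at hθ; linarith
  have hmin : ∀ r ∈ Icc 0 c, T θ s ≤ T θ r := by
    intro r hr'
    rcases le_total r τ with hrτ | hrτ
    · rw [← hsm]; exact csInf_le (hbdd _ _ _) ⟨r, ⟨hr'.1, hrτ⟩, rfl⟩
    · rw [← hst, ← htm]; exact csInf_le (hbdd _ _ _) ⟨r, ⟨hrτ, hr'.2⟩, rfl⟩
  have hm0 : 0 ≤ T θ s := by
    refine min_segMean_nonneg (α := fun u => β u - θ * (u - c / 3)) (c := c) (by fun_prop)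
      (fun u₁ u₂ u₃ h1 h2 h3 h4 => ?_) hs ht hc (hTmean θ s) ((hTmean θ t).trans hst) ?_
    · have := h u₁ u₂ u₃ h1 h2 h3 h4
      have e : (β u₁ - θ * (u₁ - c / 3)) + (β u₂ - θ * (u₂ - c / 3)) + (β u₃ - θ * (u₃ - c / 3))
        = β u₁ + β u₂ + β u₃ := by linear_combination (-θ) * h4
      rw [e]; exact this
    · intro r hr'; rw [hTmean]; exact hmin r hr'
  intro r hr'
  rw [← segMean_mul, hTmean, sub_zero]
  exact mul_nonneg hr'.1 (hm0.trans (hmin r hr'))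

/-- Dual form of the joint mixability of three copies of a decreasing density on `[0, c]` with mean
`c / 3`: any function whose sums over the simplex `u₁ + u₂ + u₃ = c` are nonnegative has
a nonnegative integral. -/
theorem integral_mul_nonneg_of_simplex {c : ℝ} (hc : 0 < c) {β κ : ℝ → ℝ} (hβ : Continuous β)
    (h : ∀ u₁ u₂ u₃ : ℝ, 0 ≤ u₁ → 0 ≤ u₂ → 0 ≤ u₃ → u₁ + u₂ + u₃ = c →
      0 ≤ β u₁ + β u₂ + β u₃)
    (hκc : ContinuousOn κ (Icc 0 c)) (hκ : AntitoneOn κ (Icc 0 c)) (hκ0 : ∀ u ∈ Icc 0 c, 0 ≤ κ u)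
    (hmean : ∫ u in (0 : ℝ)..c, (u - c / 3) * κ u = 0) :
    0 ≤ ∫ u in (0 : ℝ)..c, β u * κ u := by
  obtain ⟨θ, hθ⟩ := exists_tilt hc hβ h
  have := integral_mul_nonneg_of_antitoneOn hc.le (by fun_prop) hκ hκ0 hθ
  rw [← uIcc_of_le hc.le] at hκc
  have e : ∫ u in (0 : ℝ)..c, (β u - θ * (u - c / 3)) * κ u
      = (∫ u in (0 : ℝ)..c, β u * κ u) - θ * ∫ u in (0 : ℝ)..c, (u - c / 3) * κ u := by
    rw [← intervalIntegral.integral_const_mul, ← intervalIntegral.integral_sub]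
    · congr 1; ext u; ring
    · exact (hβ.continuousOn.mul hκc).intervalIntegrable
    · have hu : ContinuousOn (fun u : ℝ => u - c / 3) (uIcc 0 c) := by fun_prop
      exact (continuousOn_const.mul (hu.mul hκc)).intervalIntegrable
  rw [e, hmean, mul_zero, sub_zero] at this
  exact this

/-! ### Couplings carried by a compact set -/

open scoped BoundedContinuousFunction in
/-- Duality for couplings with support in a compact set `S` that is invariant under cyclic
permutations: there is a coupling of three copies of `μ` carried by `S` as soon as every function
whose coordinate sums on `S` are nonnegative has a nonnegative integral. The positive functional
`α ⊕ β ⊕ γ ↦ ∫ (α + β + γ) dμ` extends to `C(S)` and is represented by a measure. -/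
theorem exists_coupling_of_integral_nonneg {μ : Measure ℝ} [IsProbabilityMeasure μ]
    {S : Set (ℝ × ℝ × ℝ)} (hS : IsCompact S) (hrot : ∀ t ∈ S, (t.2.1, t.2.2, t.1) ∈ S)
    (hpos : ∀ α : ℝ →ᵇ ℝ, (∀ t ∈ S, 0 ≤ α t.1 + α t.2.1 + α t.2.2) → 0 ≤ ∫ x, α x ∂μ) :
    ∃ π : Measure (ℝ × ℝ × ℝ), IsFeasible μ μ π ∧ π Sᶜ = 0 := by
  have : CompactSpace S := isCompact_iff_compactSpace.mp hS
  let T : ((ℝ →ᵇ ℝ) × (ℝ →ᵇ ℝ) × (ℝ →ᵇ ℝ)) →ₗ[ℝ] C(S, ℝ) :=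
    { toFun := fun q => ⟨fun s => q.1 s.1.1 + q.2.1 s.1.2.1 + q.2.2 s.1.2.2, by fun_prop⟩
      map_add' := fun q r => by ext s; simp; ring
      map_smul' := fun k q => by ext s; simp; ring }
  let Λ : ((ℝ →ᵇ ℝ) × (ℝ →ᵇ ℝ) × (ℝ →ᵇ ℝ)) →ₗ[ℝ] ℝ :=
    { toFun := fun q => (∫ x, q.1 x ∂μ) + (∫ x, q.2.1 x ∂μ) + ∫ x, q.2.2 x ∂μ
      map_add' := fun q r => by
        simp only [Prod.fst_add, Prod.snd_add, BoundedContinuousFunction.coe_add, Pi.add_apply]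
        rw [integral_add (q.1.integrable μ) (r.1.integrable μ),
          integral_add (q.2.1.integrable μ) (r.2.1.integrable μ),
          integral_add (q.2.2.integrable μ) (r.2.2.integrable μ)]
        ring
      map_smul' := fun k q => by
        simp [integral_const_mul]; ring }
  have hTapp : ∀ q (s : S), T q s = q.1 s.1.1 + q.2.1 s.1.2.1 + q.2.2 s.1.2.2 := fun q s => rfl
  have hΛapp : ∀ q, Λ q = (∫ x, q.1 x ∂μ) + (∫ x, q.2.1 x ∂μ) + ∫ x, q.2.2 x ∂μ := fun q => rfl
  have hTΛ : ∀ q, 0 ≤ T q → 0 ≤ Λ q := by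
    intro q hq
    have h1 : 0 ≤ ∫ x, (q.1 + q.2.1 + q.2.2) x ∂μ := by
      refine hpos _ fun t ht => ?_
      -- the sum of the three cyclic shifts of `α ⊕ β ⊕ γ`
      have e1 : 0 ≤ T q ⟨t, ht⟩ := hq ⟨t, ht⟩
      have e2 : 0 ≤ T q ⟨_, hrot t ht⟩ := hq ⟨_, hrot t ht⟩
      have e3 : 0 ≤ T q ⟨_, hrot _ (hrot t ht)⟩ := hq ⟨_, hrot _ (hrot t ht)⟩
      simp only [hTapp] at e1 e2 e3
      simp only [BoundedContinuousFunction.coe_add, Pi.add_apply]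
      linarith
    simp only [BoundedContinuousFunction.coe_add, Pi.add_apply] at h1
    rw [integral_add (f := fun x => q.1 x + q.2.1 x)
        ((q.1.integrable μ).add (q.2.1.integrable μ)) (q.2.2.integrable μ),
      integral_add (q.1.integrable μ) (q.2.1.integrable μ)] at h1
    exact h1
  have hker : LinearMap.ker T ≤ LinearMap.ker Λ := by
    intro q hq
    rw [LinearMap.mem_ker] at hq ⊢
    have h1 := hTΛ q (by rw [hq])
    have h2 := hTΛ (-q) (by rw [map_neg, hq, neg_zero])
    rw [map_neg] at h2
    linarith
  obtain ⟨ℓ, hℓ⟩ : ∃ ℓ : C(S, ℝ) →ₗ[ℝ] ℝ, ℓ ∘ₗ T = Λ := by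
    have : Λ ∈ LinearMap.range T.dualMap := by
      rw [LinearMap.range_dualMap_eq_dualAnnihilator_ker, Submodule.mem_dualAnnihilator]
      exact fun q hq => hker hq
    exact this
  have hℓT : ∀ q, ℓ (T q) = Λ q := fun q => LinearMap.congr_fun hℓ q
  obtain ⟨g, hgT, hg0⟩ := riesz_extension (PointedCone.positive ℝ C(S, ℝ))
    ⟨LinearMap.range T, ℓ.domRestrict (LinearMap.range T)⟩
    (by
      rintro ⟨_, q, rfl⟩ hx
      exact (hTΛ q hx).trans_eq (hℓT q).symm)
    (by
      intro y
      refine ⟨⟨T (BoundedContinuousFunction.const ℝ ‖y‖, 0, 0), _, rfl⟩, ?_⟩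
      show 0 ≤ T (BoundedContinuousFunction.const ℝ ‖y‖, 0, 0) + y
      intro s
      have := (abs_le.1 (y.norm_coe_le_norm s)).1
      simp [hTapp]
      linarith)
  have hgΛ : ∀ q, g (T q) = Λ q := fun q => (hgT ⟨T q, q, rfl⟩).trans (hℓT q)
  let G : CompactlySupportedContinuousMap S ℝ →ₗ[ℝ] ℝ :=
    { toFun := fun φ => g φ.toContinuousMap
      map_add' := fun φ φ' => map_add g φ.toContinuousMap φ'.toContinuousMap
      map_smul' := fun k φ => map_smul g k φ.toContinuousMap }
  let Γ : CompactlySupportedContinuousMap S ℝ →ₚ[ℝ] ℝ :=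
    PositiveLinearMap.mk₀ G fun φ hφ => hg0 φ.toContinuousMap fun s => hφ s
  set ν := RealRMK.rieszMeasure Γ with hν
  have hνint : ∀ φ : C(S, ℝ), ∫ s, φ s ∂ν = g φ := fun φ =>
    RealRMK.integral_rieszMeasure Γ ⟨φ, HasCompactSupport.of_compactSpace _⟩
  have hmap : ∀ (pr : ℝ × ℝ × ℝ → ℝ), Continuous pr →
      (∀ α : ℝ →ᵇ ℝ, ∫ s : S, α (pr s.1) ∂ν = ∫ x, α x ∂μ) →
      (ν.map Subtype.val).map pr = μ := by
    intro pr hpr h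
    have : IsFiniteMeasure ((ν.map (Subtype.val : S → ℝ × ℝ × ℝ)).map pr) := by infer_instance
    refine ext_of_forall_integral_eq_of_IsFiniteMeasure fun α => ?_
    rw [integral_map hpr.aemeasurable (by fun_prop),
      integral_map measurable_subtype_coe.aemeasurable (by fun_prop)]
    exact h α
  have h1 : (ν.map Subtype.val).map (fun t : ℝ × ℝ × ℝ => t.1) = μ :=
    hmap _ (by fun_prop) fun α => by
      have := hνint (T (α, 0, 0))
      rw [hgΛ, hΛapp] at this
      simpa [hTapp] using this
  have h2 : (ν.map Subtype.val).map (fun t : ℝ × ℝ × ℝ => t.2.1) = μ :=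
    hmap _ (by fun_prop) fun α => by
      have := hνint (T (0, α, 0))
      rw [hgΛ, hΛapp] at this
      simpa [hTapp] using this
  have h3 : (ν.map Subtype.val).map (fun t : ℝ × ℝ × ℝ => t.2.2) = μ :=
    hmap _ (by fun_prop) fun α => by
      have := hνint (T (0, 0, α))
      rw [hgΛ, hΛapp] at this
      simpa [hTapp] using this
  refine ⟨ν.map Subtype.val, ⟨⟨?_⟩, h1, h2, h3⟩, ?_⟩
  · have e : (ν.map Subtype.val).map (fun t : ℝ × ℝ × ℝ => t.1) univ = 1 := by
      rw [h1]; exact measure_univ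
    rwa [Measure.map_apply (by fun_prop) MeasurableSet.univ, preimage_univ] at e
  · rw [Measure.map_apply measurable_subtype_coe hS.measurableSet.compl]
    simp

/-! ### Distribution and quantile functions -/

variable {μ : Measure ℝ} {f : ℝ → ℝ} {pl : ℝ}

theorem IsTypeDistribution.measure_compl_Icc (hμ : IsTypeDistribution μ f) :
    μ (Icc (0 : ℝ) 1)ᶜ = 0 := by
  have h : (volume.restrict (Icc (0 : ℝ) 1)) (Icc (0 : ℝ) 1)ᶜ = 0 := by
    rw [Measure.restrict_apply measurableSet_Icc.compl]; simp
  have hac : μ ≪ volume.restrict (Icc (0 : ℝ) 1) := by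
    conv_lhs => rw [hμ.eq_withDensity]
    exact withDensity_absolutelyContinuous _ _
  exact hac h

theorem IsTypeDistribution.measure_singleton (hμ : IsTypeDistribution μ f) (x : ℝ) :
    μ {x} = 0 := by
  have hac : μ ≪ volume.restrict (Icc (0 : ℝ) 1) := by
    conv_lhs => rw [hμ.eq_withDensity]
    exact withDensity_absolutelyContinuous _ _
  exact hac (by simp)

theorem IsTypeDistribution.continuous_cdf (hμ : IsTypeDistribution μ f) :
    Continuous (cdf μ) := by
  have := hμ.prob
  refine continuous_iff_continuousAt.2 fun x => ?_
  rw [(monotone_cdf μ).continuousAt_iff_leftLim_eq_rightLim, (cdf μ).rightLim_eq]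
  have h := (cdf μ).measure_singleton x
  rw [measure_cdf, hμ.measure_singleton] at h
  exact le_antisymm ((monotone_cdf μ).leftLim_le le_rfl)
    (sub_nonpos.1 (ENNReal.ofReal_eq_zero.1 h.symm))

theorem IsTypeDistribution.cdf_zero (hμ : IsTypeDistribution μ f) : cdf μ 0 = 0 := by
  have := hμ.prob
  have hsub : Iio (0 : ℝ) ⊆ (Icc (0 : ℝ) 1)ᶜ := fun x hx hx' => absurd hx'.1 (not_le.2 hx)
  have h1 : μ (Iio 0) = 0 := measure_mono_null hsub hμ.measure_compl_Icc
  have h2 : μ (Iic 0) = 0 := by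
    rw [← Iio_union_right]; exact measure_union_null h1 (hμ.measure_singleton 0)
  rw [cdf_eq_real, Measure.real, h2, ENNReal.toReal_zero]

theorem IsTypeDistribution.cdf_one (hμ : IsTypeDistribution μ f) : cdf μ 1 = 1 := by
  have := hμ.prob
  have h1 : μ (Iic 1)ᶜ = 0 := measure_mono_null
    (compl_subset_compl.2 Icc_subset_Iic_self) hμ.measure_compl_Icc
  rw [cdf_eq_real, Measure.real, (prob_compl_eq_zero_iff measurableSet_Iic).1 h1,
    ENNReal.toReal_one]

theorem IsTypeDistribution.exists_cdf_eq (hμ : IsTypeDistribution μ f) {p : ℝ}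
    (hp : p ∈ Icc (0 : ℝ) 1) : ∃ x ∈ Icc (0 : ℝ) 1, cdf μ x = p := by
  have := intermediate_value_Icc (zero_le_one (α := ℝ)) hμ.continuous_cdf.continuousOn
  rw [hμ.cdf_zero, hμ.cdf_one] at this
  exact this hp

theorem IsTypeDistribution.quantile_mem (hμ : IsTypeDistribution μ f) {p : ℝ}
    (hp : p ∈ Icc (0 : ℝ) 1) : quantile μ p ∈ Icc (0 : ℝ) 1 :=
  Function.invFunOn_mem (hμ.exists_cdf_eq hp)

theorem IsTypeDistribution.cdf_quantile (hμ : IsTypeDistribution μ f) {p : ℝ}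
    (hp : p ∈ Icc (0 : ℝ) 1) : cdf μ (quantile μ p) = p :=
  Function.invFunOn_eq (hμ.exists_cdf_eq hp)

theorem cdf_mem (μ : Measure ℝ) (x : ℝ) : cdf μ x ∈ Icc (0 : ℝ) 1 :=
  ⟨cdf_nonneg μ x, cdf_le_one μ x⟩

theorem IsTypeDistribution.quantile_cdf (hμ : IsTypeDistribution μ f) {x : ℝ}
    (hx : x ∈ Icc (0 : ℝ) 1) : quantile μ (cdf μ x) = x :=
  hμ.cdf_strictMono.injOn (hμ.quantile_mem (cdf_mem μ x)) hx (hμ.cdf_quantile (cdf_mem μ x))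

theorem IsTypeDistribution.quantile_zero (hμ : IsTypeDistribution μ f) : quantile μ 0 = 0 := by
  conv_lhs => rw [← hμ.cdf_zero]
  exact hμ.quantile_cdf ⟨le_rfl, zero_le_one⟩

theorem IsTypeDistribution.quantile_one (hμ : IsTypeDistribution μ f) : quantile μ 1 = 1 := by
  conv_lhs => rw [← hμ.cdf_one]
  exact hμ.quantile_cdf ⟨zero_le_one, le_rfl⟩

theorem IsTypeDistribution.quantile_strictMono (hμ : IsTypeDistribution μ f) :
    StrictMonoOn (quantile μ) (Icc 0 1) := by
  intro p hp q hq hpq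
  by_contra! h
  have := (monotone_cdf μ) h
  rw [hμ.cdf_quantile hp, hμ.cdf_quantile hq] at this
  exact absurd hpq (not_lt.2 this)

theorem IsTypeDistribution.quantile_mono (hμ : IsTypeDistribution μ f) {p q : ℝ} (hp : 0 ≤ p)
    (hpq : p ≤ q) (hq : q ≤ 1) : quantile μ p ≤ quantile μ q :=
  hμ.quantile_strictMono.monotoneOn ⟨hp, hpq.trans hq⟩ ⟨hp.trans hpq, hq⟩ hpq

theorem IsTypeDistribution.quantile_pos (hμ : IsTypeDistribution μ f) {p : ℝ} (hp : 0 < p)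
    (hp1 : p ≤ 1) : 0 < quantile μ p := by
  have := hμ.quantile_strictMono ⟨le_rfl, zero_le_one⟩ ⟨hp.le, hp1⟩ hp
  rwa [hμ.quantile_zero] at this

theorem IsTypeDistribution.quantile_lt_one (hμ : IsTypeDistribution μ f) {p : ℝ} (hp : 0 ≤ p)
    (hp1 : p < 1) : quantile μ p < 1 := by
  have := hμ.quantile_strictMono ⟨hp, hp1.le⟩ ⟨zero_le_one, le_rfl⟩ hp1
  rwa [hμ.quantile_one] at this

theorem IsTypeDistribution.quantile_le_iff (hμ : IsTypeDistribution μ f) {p x : ℝ}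
    (hp : p ∈ Icc (0 : ℝ) 1) (hx : 0 ≤ x) : quantile μ p ≤ x ↔ p ≤ cdf μ x := by
  constructor
  · intro h
    have := (monotone_cdf μ) h
    rwa [hμ.cdf_quantile hp] at this
  · intro h
    rcases le_total x 1 with hx1 | hx1
    · have := hμ.quantile_mono hp.1 h (cdf_le_one μ x)
      rwa [hμ.quantile_cdf ⟨hx, hx1⟩] at this
    · exact (hμ.quantile_mem hp).2.trans hx1

theorem IsTypeDistribution.continuousOn_quantile (hμ : IsTypeDistribution μ f) :
    ContinuousOn (quantile μ) (Icc 0 1) := by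
  let q : Icc (0 : ℝ) 1 → Icc (0 : ℝ) 1 := fun p => ⟨quantile μ p, hμ.quantile_mem p.2⟩
  have hmono : Monotone q := fun p r hpr => hμ.quantile_strictMono.monotoneOn p.2 r.2 hpr
  have hsurj : Function.Surjective q := fun x =>
    ⟨⟨cdf μ x, cdf_mem μ x⟩, Subtype.ext (hμ.quantile_cdf x.2)⟩
  rw [continuousOn_iff_continuous_domRestrict]
  exact continuous_subtype_val.comp (hmono.continuous_of_surjective hsurj)

theorem IsTypeDistribution.aemeasurable_quantile (hμ : IsTypeDistribution μ f) :
    AEMeasurable (quantile μ) (volume.restrict (Icc 0 1)) :=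
  hμ.continuousOn_quantile.aemeasurable measurableSet_Icc

theorem IsTypeDistribution.map_quantile (hμ : IsTypeDistribution μ f) :
    (volume.restrict (Icc 0 1)).map (quantile μ) = μ := by
  have := hμ.prob
  have hfin : IsFiniteMeasure ((volume.restrict (Icc (0 : ℝ) 1)).map (quantile μ)) := by
    infer_instance
  refine Measure.ext_of_Iic _ _ fun x => ?_
  rw [Measure.map_apply_of_aemeasurable hμ.aemeasurable_quantile measurableSet_Iic,
    Measure.restrict_apply' measurableSet_Icc, ← ofReal_cdf]
  rcases lt_or_ge x 0 with hx | hx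
  · have h1 : cdf μ x = 0 := le_antisymm (((monotone_cdf μ) hx.le).trans_eq hμ.cdf_zero)
      (cdf_nonneg μ x)
    have h2 : quantile μ ⁻¹' Iic x ∩ Icc 0 1 = ∅ := by
      ext p
      simp only [mem_inter_iff, mem_preimage, mem_Iic, mem_empty_iff_false, iff_false, not_and]
      exact fun h hp => absurd ((hμ.quantile_mem hp).1.trans h) (not_le.2 hx)
    simp [h1, h2]
  · have h2 : quantile μ ⁻¹' Iic x ∩ Icc 0 1 = Icc 0 (cdf μ x) := by
      ext p
      simp only [mem_inter_iff, mem_preimage, mem_Iic]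
      constructor
      · rintro ⟨h, hp⟩
        exact ⟨hp.1, (hμ.quantile_le_iff hp hx).1 h⟩
      · intro h
        have hp : p ∈ Icc (0 : ℝ) 1 := ⟨h.1, h.2.trans (cdf_le_one μ x)⟩
        exact ⟨(hμ.quantile_le_iff hp hx).2 h.2, hp⟩
    rw [h2, Real.volume_Icc, sub_zero]

theorem IsTypeDistribution.integral_eq_quantile (hμ : IsTypeDistribution μ f) {α : ℝ → ℝ}
    (hα : Continuous α) : ∫ x, α x ∂μ = ∫ p in (0 : ℝ)..1, α (quantile μ p) := by
  conv_lhs => rw [← hμ.map_quantile]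
  rw [integral_map hμ.aemeasurable_quantile hα.aestronglyMeasurable,
    intervalIntegral.integral_of_le zero_le_one, integral_Icc_eq_integral_Ioc]

theorem IsTypeDistribution.cdf_sub_cdf (hμ : IsTypeDistribution μ f) {x y : ℝ} (hx : 0 < x)
    (hxy : x ≤ y) (hy : y < 1) : cdf μ y - cdf μ x = ∫ s in x..y, f s := by
  have := hμ.prob
  have h1 : μ (Ioc x y) = ENNReal.ofReal (cdf μ y - cdf μ x) := by
    conv_lhs => rw [← measure_cdf μ]
    exact (cdf μ).measure_Ioc x y
  have hsub : Icc x y ⊆ Ioo 0 1 := fun s hs => ⟨hx.trans_le hs.1, hs.2.trans_lt hy⟩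
  have h2 : μ (Ioc x y) = ∫⁻ s in Ioc x y, ENNReal.ofReal (f s) := by
    conv_lhs => rw [hμ.eq_withDensity]
    rw [withDensity_apply _ measurableSet_Ioc, Measure.restrict_restrict measurableSet_Ioc,
      inter_eq_left.2 (Ioc_subset_Icc_self.trans (hsub.trans Ioo_subset_Icc_self))]
  have hint : IntegrableOn f (Ioc x y) :=
    ((hμ.density_continuous.mono hsub).integrableOn_Icc).mono_set Ioc_subset_Icc_self
  have hnn : 0 ≤ᵐ[volume.restrict (Ioc x y)] f :=
    (ae_restrict_iff' measurableSet_Ioc).2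
      (.of_forall fun s hs => hμ.density_nonneg s (hsub (Ioc_subset_Icc_self hs)))
  rw [← ofReal_integral_eq_lintegral_ofReal hint hnn] at h2
  rw [intervalIntegral.integral_of_le hxy]
  exact (ENNReal.ofReal_eq_ofReal_iff (sub_nonneg.2 (monotone_cdf μ hxy))
    (integral_nonneg_of_ae hnn)).1 (h1.symm.trans h2)

theorem IsTypeDistribution.hasDerivAt_cdf (hμ : IsTypeDistribution μ f) {x : ℝ}
    (hx : x ∈ Ioo (0 : ℝ) 1) : HasDerivAt (cdf μ) (f x) x := by
  obtain ⟨y, hy0, hyx⟩ := exists_between hx.1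
  have hint : ∀ s ∈ Ioo (0 : ℝ) 1, IntervalIntegrable f volume y s := fun s hs =>
    (hμ.density_continuous.mono
      (ordConnected_Ioo.uIcc_subset ⟨hy0, hyx.trans hx.2⟩ hs)).intervalIntegrable
  have h := intervalIntegral.integral_hasDerivAt_right (hint x hx)
    (hμ.density_continuous.stronglyMeasurableAtFilter isOpen_Ioo x hx)
    (hμ.density_continuous.continuousAt (Ioo_mem_nhds hx.1 hx.2))
  refine (h.const_add (cdf μ y)).congr_of_eventuallyEq ?_
  filter_upwards [Ioo_mem_nhds hyx hx.2] with s hs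
  rw [← hμ.cdf_sub_cdf hy0 hs.1.le hs.2]; ring

/-- Substitution `p = F(x)`. -/
theorem IsTypeDistribution.integral_comp_quantile (hμ : IsTypeDistribution μ f) {x y : ℝ}
    (hx : 0 < x) (hxy : x ≤ y) (hy : y < 1) {ψ : ℝ → ℝ} (hψ : ContinuousOn ψ (Icc x y)) :
    ∫ p in cdf μ x..cdf μ y, ψ (quantile μ p) = ∫ s in x..y, ψ s * f s := by
  have hsub : Icc x y ⊆ Ioo 0 1 := fun s hs => ⟨hx.trans_le hs.1, hs.2.trans_lt hy⟩
  have hmaps : cdf μ '' uIcc x y ⊆ Icc (cdf μ x) (cdf μ y) := by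
    rw [uIcc_of_le hxy]
    rintro _ ⟨s, hs, rfl⟩
    exact ⟨monotone_cdf μ hs.1, monotone_cdf μ hs.2⟩
  have hq : MapsTo (quantile μ) (Icc (cdf μ x) (cdf μ y)) (Icc x y) := by
    intro p hp
    have hx' : x ∈ Icc (0 : ℝ) 1 := ⟨hx.le, hxy.trans hy.le⟩
    have hy' : y ∈ Icc (0 : ℝ) 1 := ⟨hx.le.trans hxy, hy.le⟩
    have h1 := hμ.quantile_mono (cdf_nonneg μ x) hp.1 (hp.2.trans (cdf_le_one μ y))
    have h2 := hμ.quantile_mono ((cdf_nonneg μ x).trans hp.1) hp.2 (cdf_le_one μ y)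
    rw [hμ.quantile_cdf hx'] at h1
    rw [hμ.quantile_cdf hy'] at h2
    exact ⟨h1, h2⟩
  have hc : ContinuousOn (ψ ∘ quantile μ) (cdf μ '' uIcc x y) :=
    (hψ.comp (hμ.continuousOn_quantile.mono fun p hp =>
      ⟨(cdf_nonneg μ x).trans hp.1, hp.2.trans (cdf_le_one μ y)⟩) hq).mono hmaps
  rw [← show ∫ s in x..y, (ψ ∘ quantile μ ∘ cdf μ) s * f s = ∫ s in x..y, ψ s * f s from
    intervalIntegral.integral_congr fun s hs => by
      rw [uIcc_of_le hxy] at hs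
      simp only [Function.comp_apply]
      rw [hμ.quantile_cdf ⟨(hsub hs).1.le, (hsub hs).2.le⟩]]
  exact (intervalIntegral.integral_comp_mul_deriv'' (g := ψ ∘ quantile μ)
    hμ.continuous_cdf.continuousOn
    (fun s hs => (hμ.hasDerivAt_cdf (hsub (by
      rw [min_eq_left hxy, max_eq_right hxy] at hs; exact ⟨hs.1.le, hs.2.le⟩))).hasDerivWithinAt)
    (by rw [uIcc_of_le hxy]; exact hμ.density_continuous.mono hsub) hc).symm

/-! ### The logarithmic loss and the cutoff -/

theorem IsLowerCutoff.mem (hpl : IsLowerCutoff μ pl) : pl ∈ Ioc (0 : ℝ) (1 / 3) := by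
  rcases hpl with ⟨h, -⟩ | ⟨rfl, -⟩
  · exact ⟨h.1, h.2.le⟩
  · norm_num

theorem IsTypeDistribution.continuousOn_log_quantile (hμ : IsTypeDistribution μ f) :
    ContinuousOn (fun p => Real.log (quantile μ p)) (Ioc 0 1) :=
  (hμ.continuousOn_quantile.mono Ioc_subset_Icc_self).log
    fun _ hp => (hμ.quantile_pos hp.1 hp.2).ne'

theorem IsTypeDistribution.continuousOn_log_quantile_upper (hμ : IsTypeDistribution μ f) :
    ContinuousOn (fun p => Real.log (quantile μ (1 - 2 * p))) (Ioc 0 (1 / 3)) :=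
  hμ.continuousOn_log_quantile.comp (f := fun p : ℝ => 1 - 2 * p) (by fun_prop) fun p hp =>
    ⟨by linarith [hp.2], by linarith [hp.1]⟩

theorem IsTypeDistribution.continuousOn_logLoss (hμ : IsTypeDistribution μ f) :
    ContinuousOn (logLoss μ) (Ioc 0 (1 / 3)) :=
  (continuousOn_const.mul hμ.continuousOn_log_quantile_upper).add
    (hμ.continuousOn_log_quantile.mono (Ioc_subset_Ioc_right (by norm_num)))

theorem IsTypeDistribution.exp_logLoss (hμ : IsTypeDistribution μ f) {p : ℝ}
    (hp : p ∈ Ioc (0 : ℝ) (1 / 3)) :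
    Real.exp (logLoss μ p) = quantile μ (1 - 2 * p) ^ 2 * quantile μ p := by
  have h1 := hμ.quantile_pos (p := 1 - 2 * p) (by linarith [hp.2]) (by linarith [hp.1])
  have h2 := hμ.quantile_pos hp.1 (by linarith [hp.2])
  rw [logLoss, Real.exp_add, Real.exp_log h2, mul_comm 2, Real.exp_mul, Real.exp_log h1]
  norm_num

/-- The integral of `log I` over the middle percentiles is an integral of the logarithmic loss, so
that the cutoff equation says that `L(q)` is the mean of `L` over `[q, 1/3]`. -/
theorem IsTypeDistribution.integral_logLoss (hμ : IsTypeDistribution μ f) {q : ℝ}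
    (hq : q ∈ Ioc (0 : ℝ) (1 / 3)) :
    ∫ p in q..(1 / 3), logLoss μ p = ∫ p in q..(1 - 2 * q), Real.log (quantile μ p) := by
  have hi : ∀ a b : ℝ, 0 < a → a ≤ b → b ≤ 1 →
      IntervalIntegrable (fun p => Real.log (quantile μ p)) volume a b := fun a b ha hab hb =>
    (hμ.continuousOn_log_quantile.mono fun p hp =>
      ⟨ha.trans_le hp.1, hp.2.trans hb⟩).intervalIntegrable_of_Icc hab
  have hi2 : IntervalIntegrable (fun p => 2 * Real.log (quantile μ (1 - 2 * p))) volume q (1 / 3) :=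
    ((continuousOn_const.mul hμ.continuousOn_log_quantile_upper).mono fun p hp =>
      ⟨hq.1.trans_le hp.1, hp.2⟩).intervalIntegrable_of_Icc hq.2
  have hsub := intervalIntegral.integral_comp_sub_mul (a := q) (b := 1 / 3)
    (fun p => Real.log (quantile μ p)) (two_ne_zero (α := ℝ)) 1
  simp only [logLoss]
  rw [intervalIntegral.integral_add hi2 (hi _ _ hq.1 hq.2 (by norm_num)),
    intervalIntegral.integral_const_mul, hsub,
    show (1 : ℝ) - 2 * (1 / 3) = 1 / 3 by norm_num, smul_eq_mul, mul_inv_cancel_left₀ two_ne_zero,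
    add_comm]
  exact intervalIntegral.integral_add_adjacent_intervals (hi _ _ hq.1 hq.2 (by norm_num))
    (hi _ _ (by norm_num) (by linarith [hq.2]) (by linarith [hq.1]))

theorem IsTypeDistribution.cutoffEquation_iff (hμ : IsTypeDistribution μ f) {q : ℝ}
    (hq : q ∈ Ioo (0 : ℝ) (1 / 3)) :
    CutoffEquation μ q ↔ ∫ p in q..(1 / 3), logLoss μ p = (1 / 3 - q) * logLoss μ q := by
  have hq' : q ∈ Ioc (0 : ℝ) (1 / 3) := ⟨hq.1, hq.2.le⟩
  have h0 : (1 / 3 - q) ≠ 0 := (sub_pos.2 hq.2).ne'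
  rw [CutoffEquation, lossConstant, ← hμ.integral_logLoss hq', ← hμ.exp_logLoss hq',
    Real.exp_eq_exp, one_div (1 / 3 - q), inv_mul_eq_iff_eq_mul₀ h0]

/-- At the cutoff the identity of the cutoff equation holds also if the cutoff is `1/3`, where both
sides vanish. -/
theorem IsTypeDistribution.integral_logLoss_cutoff (hμ : IsTypeDistribution μ f)
    (hpl : IsLowerCutoff μ pl) :
    ∫ p in pl..(1 - 2 * pl), Real.log (quantile μ p) = (1 / 3 - pl) * logLoss μ pl := by
  rw [← hμ.integral_logLoss hpl.mem]
  rcases hpl with ⟨h, heq⟩ | ⟨rfl, -⟩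
  · exact (hμ.cutoffEquation_iff h).1 heq
  · simp

/-- Concavity makes the cutoff a maximizer of the logarithmic loss over the matched percentiles. -/
theorem IsTypeDistribution.logLoss_le_cutoff (hμ : IsTypeDistribution μ f)
    (hpl : IsLowerCutoff μ pl) (hconc : ConcaveOn ℝ (Ioc 0 (1 / 3)) (logLoss μ)) {p : ℝ}
    (hp : p ∈ Ioc 0 pl) : logLoss μ p ≤ logLoss μ pl := by
  by_contra! hlt
  have hplm := hpl.mem
  have hp3 : p ∈ Ioc (0 : ℝ) (1 / 3) := ⟨hp.1, hp.2.trans hplm.2⟩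
  rcases hpl with ⟨h, heq⟩ | ⟨rfl, hno⟩
  · -- `L` then falls strictly to the right of the cutoff, below its mean
    rw [hμ.cutoffEquation_iff h] at heq
    have hppl : p < pl := lt_of_le_of_ne hp.2 (by rintro rfl; exact lt_irrefl _ hlt)
    have hfall : ∀ q ∈ Ioc pl (1 / 3), logLoss μ q < logLoss μ pl := fun q hq =>
      hconc.lt_right_of_left_lt hp3 ⟨hplm.1.trans hq.1, hq.2⟩
        (by rw [openSegment_eq_Ioo (hppl.trans hq.1)]; exact ⟨hppl, hq.1⟩) hlt
    have := intervalIntegral.integral_lt_integral_of_continuousOn_of_le_of_exists_lt h.2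
      (hμ.continuousOn_logLoss.mono fun q hq => ⟨hplm.1.trans_le hq.1, hq.2⟩)
      (continuousOn_const (c := logLoss μ pl)) (fun q hq => (hfall q hq).le)
      ⟨1 / 3, ⟨h.2.le, le_rfl⟩, hfall _ ⟨h.2, le_rfl⟩⟩
    rw [heq] at this
    simp at this
  · -- the excess of `L(q)` over its mean on `[q, 1/3]` changes sign, against the choice of `1/3`
    obtain ⟨q₂, hq₂, hmax⟩ := isCompact_Icc.exists_isMaxOn (s := Icc p (1 / 3))
      ⟨p, le_rfl, hp.2⟩ (hμ.continuousOn_logLoss.mono fun q hq => ⟨hp.1.trans_le hq.1, hq.2⟩)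
    have hq₂3 : q₂ < 1 / 3 := lt_of_le_of_ne hq₂.2 (by
      rintro rfl
      exact absurd (hmax ⟨le_rfl, hp.2⟩) (not_le.2 hlt))
    have hq₂0 : 0 < q₂ := hp.1.trans_le hq₂.1
    -- a percentile with so small a skill that its loss is below the one at `1/3`
    obtain ⟨q₁, hq₁0, hq₁2, hq₁3⟩ : ∃ q₁, 0 < q₁ ∧ q₁ < q₂ ∧ logLoss μ q₁ < logLoss μ (1 / 3) := by
      have hcont : Filter.Tendsto (quantile μ) (nhdsWithin 0 (Ioi 0)) (nhds 0) := by
        have : ContinuousWithinAt (quantile μ) (Ioi 0) 0 :=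
          (hμ.continuousOn_quantile 0 ⟨le_rfl, zero_le_one⟩).mono_of_mem_nhdsWithin
          (Filter.mem_of_superset (Ioc_mem_nhdsGT (zero_lt_one (α := ℝ)))
            Ioc_subset_Icc_self)
        have h2 := this.tendsto
        rwa [hμ.quantile_zero] at h2
      have hev := (hcont.eventually_lt_const (Real.exp_pos (logLoss μ (1 / 3)))).and
        (Ioo_mem_nhdsGT hq₂0)
      obtain ⟨q₁, h1, h2⟩ := hev.exists
      refine ⟨q₁, h2.1, h2.2, ?_⟩
      have hq₁ : q₁ ∈ Ioc (0 : ℝ) (1 / 3) := ⟨h2.1, (h2.2.trans hq₂3).le⟩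
      rw [← Real.exp_lt_exp, hμ.exp_logLoss hq₁]
      have hu := hμ.quantile_mem (p := 1 - 2 * q₁)
        ⟨by linarith [hq₁.2], by linarith [hq₁.1]⟩
      have hv := (hμ.quantile_pos h2.1 (by linarith [hq₁.2])).le
      exact (mul_le_of_le_one_left hv (pow_le_one₀ hu.1 hu.2)).trans_lt h1
    have hsub : ∀ q, 0 < q → Icc q (1 / 3) ⊆ Ioc (0 : ℝ) (1 / 3) :=
      fun q hq r hr => ⟨hq.trans_le hr.1, hr.2⟩
    have hq₁lt : q₁ < 1 / 3 := hq₁2.trans hq₂3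
    set E : ℝ → ℝ := fun q => (1 / 3 - q) * logLoss μ q - ∫ r in q..(1 / 3), logLoss μ r with hE
    have hEc : ContinuousOn E (Icc q₁ q₂) := by
      have hc := hμ.continuousOn_logLoss.mono (hsub q₁ hq₁0)
      have h1 : ContinuousOn (fun q => ∫ r in q..(1 / 3), logLoss μ r) (Icc q₁ (1 / 3)) := by
        have := intervalIntegral.continuousOn_primitive_interval_left (f := logLoss μ) (μ := volume)
          (a := q₁) (b := 1 / 3) (by rw [uIcc_of_le hq₁lt.le]; exact hc.integrableOn_Icc)
        rwa [uIcc_of_le hq₁lt.le] at this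
      exact (((by fun_prop : ContinuousOn (fun q : ℝ => 1 / 3 - q) (Icc q₁ (1 / 3))).mul hc).sub
        h1).mono (Icc_subset_Icc_right hq₂3.le)
    have hE1 : E q₁ ≤ 0 := by
      have := intervalIntegral.integral_mono_on hq₁lt.le
        (intervalIntegrable_const (μ := volume) (c := logLoss μ q₁))
        ((hμ.continuousOn_logLoss.mono (hsub q₁ hq₁0)).intervalIntegrable_of_Icc hq₁lt.le)
        (fun q hq => (by
          rw [← min_eq_left hq₁3.le]
          exact hconc.min_le_of_mem_Icc ⟨hq₁0, hq₁lt.le⟩ ⟨by norm_num, le_rfl⟩ hq))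
      simp at this
      simp only [hE]; linarith
    have hE2 : 0 ≤ E q₂ := by
      have := intervalIntegral.integral_mono_on hq₂3.le
        ((hμ.continuousOn_logLoss.mono (hsub q₂ hq₂0)).intervalIntegrable_of_Icc hq₂3.le)
        (intervalIntegrable_const (μ := volume) (c := logLoss μ q₂))
        (fun q hq => hmax ⟨hq₂.1.trans hq.1, hq.2⟩)
      simp at this
      simp only [hE]; linarith
    obtain ⟨q, hq, hqE⟩ := intermediate_value_Icc hq₁2.le hEc ⟨hE1, hE2⟩
    have hq3 : q ∈ Ioo (0 : ℝ) (1 / 3) := ⟨hq₁0.trans_le hq.1, hq.2.trans_lt hq₂3⟩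
    exact hno q hq3 ((hμ.cutoffEquation_iff hq3).2 (by simp only [hE] at hqE; linarith))

theorem IsTypeDistribution.logLoss_monotoneOn (hμ : IsTypeDistribution μ f)
    (hpl : IsLowerCutoff μ pl) (hconc : ConcaveOn ℝ (Ioc 0 (1 / 3)) (logLoss μ)) :
    MonotoneOn (logLoss μ) (Ioc 0 pl) := by
  intro p hp q hq hpq
  have hplm := hpl.mem
  rw [← min_eq_left (hμ.logLoss_le_cutoff hpl hconc hp)]
  exact hconc.min_le_of_mem_Icc ⟨hp.1, hp.2.trans hplm.2⟩ hplm ⟨hpq, hq.2⟩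

/-- The logarithmic loss is strictly increasing until it reaches its maximum. -/
theorem IsTypeDistribution.logLoss_eq_cutoff_of_eq (hμ : IsTypeDistribution μ f)
    (hpl : IsLowerCutoff μ pl) (hconc : ConcaveOn ℝ (Ioc 0 (1 / 3)) (logLoss μ)) {p q : ℝ}
    (hp : 0 < p) (hpq : p < q) (hq : q ≤ pl) (h : logLoss μ p = logLoss μ q) :
    logLoss μ q = logLoss μ pl := by
  have hplm := hpl.mem
  have hq0 := hp.trans hpq
  refine le_antisymm (hμ.logLoss_le_cutoff hpl hconc ⟨hq0, hq⟩) ?_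
  rcases hq.eq_or_lt with rfl | hlt
  · exact le_rfl
  by_contra! hgt
  have := hconc.left_lt_of_lt_right (z := q) ⟨hp, (hpq.le.trans hq).trans hplm.2⟩ hplm
    (by rw [openSegment_eq_Ioo (hpq.trans hlt)]; exact ⟨hpq, hlt⟩) hgt
  exact absurd h this.ne

/-! ### Critical teams and dual feasibility -/

/-- The shape of the equilibrium: skills in `[0, a]` are matched through the decreasing bijection
`D : [0, a] → [b, 1]` (with inverse `U`) to teams `(x, D x, D x)`, skills in `[a, b]` work in teams
of constant loss `a b²`, and `g x` is the product of the other two types in a team of `x`. The loss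
`x (D x)²` increases, strictly so until it reaches its maximum `a b²`. -/
structure MatchingCurve (a b : ℝ) (D U g : ℝ → ℝ) : Prop where
  a_pos : 0 < a
  a_le : a ≤ b
  b_lt : b < 1
  D_anti : StrictAntiOn D (Icc 0 a)
  D_cont : ContinuousOn D (Icc 0 a)
  D_zero : D 0 = 1
  D_a : D a = b
  U_mem : ∀ y ∈ Icc b 1, U y ∈ Icc 0 a
  D_U : ∀ y ∈ Icc b 1, D (U y) = y
  U_cont : ContinuousOn U (Icc b 1)
  g_low : ∀ x ∈ Icc 0 a, g x = D x ^ 2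
  g_mid : ∀ x ∈ Icc a b, g x = a * b ^ 2 / x
  g_high : ∀ x ∈ Icc b 1, g x = x * U x
  loss_mono : MonotoneOn (fun x => x * D x ^ 2) (Icc 0 a)
  loss_flat : ∀ x y, 0 ≤ x → x < y → y ≤ a → x * D x ^ 2 = y * D y ^ 2 → y * D y ^ 2 = a * b ^ 2

/-- Teams in which the product of any two types is `g` of the third. When `g` is the derivative of
`Φ`, these are the critical points of `x₁ x₂ x₃ - Φ(x₁) - Φ(x₂) - Φ(x₃)`. -/
def criticalTeams (g : ℝ → ℝ) : Set (ℝ × ℝ × ℝ) :=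
  {t | (t.1 ∈ types ∧ t.2.1 ∈ types ∧ t.2.2 ∈ types) ∧
    t.2.1 * t.2.2 = g t.1 ∧ t.1 * t.2.2 = g t.2.1 ∧ t.1 * t.2.1 = g t.2.2}

/-- The slack of the dual constraint `Φ(x) + Φ(y) + Φ(z) ≤ x y z` for the primitive `Φ` of `g`. -/
noncomputable def slack (g : ℝ → ℝ) (x y z : ℝ) : ℝ :=
  x * y * z - (∫ s in (0 : ℝ)..x, g s) - (∫ s in (0 : ℝ)..y, g s) - ∫ s in (0 : ℝ)..z, g s

theorem criticalTeams_rotate {g : ℝ → ℝ} {t : ℝ × ℝ × ℝ} (ht : t ∈ criticalTeams g) :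
    (t.2.1, t.2.2, t.1) ∈ criticalTeams g := by
  obtain ⟨⟨h1, h2, h3⟩, e1, e2, e3⟩ := ht
  exact ⟨⟨h2, h3, h1⟩, by simp only; linarith, by simp only; linarith, by simp only; linarith⟩

theorem isCompact_criticalTeams {g : ℝ → ℝ} (hg : ContinuousOn g (Icc 0 1)) :
    IsCompact (criticalTeams g) := by
  set k : ℝ → ℝ := IccExtend zero_le_one ((Icc (0 : ℝ) 1).domRestrict g) with hk
  have hkc : Continuous k := (continuousOn_iff_continuous_domRestrict.1 hg).Icc_extend'
  have hkg : ∀ x ∈ types, k x = g x := fun x hx => IccExtend_of_mem _ _ hx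
  have : criticalTeams g = (types ×ˢ types ×ˢ types) ∩
      {t : ℝ × ℝ × ℝ | t.2.1 * t.2.2 = k t.1 ∧ t.1 * t.2.2 = k t.2.1 ∧ t.1 * t.2.1 = k t.2.2} := by
    ext t
    simp only [criticalTeams, mem_ofPred_eq, mem_inter_iff, mem_prod]
    refine and_congr_right fun h => ?_
    rw [hkg _ h.1, hkg _ h.2.1, hkg _ h.2.2]
  rw [this]
  have hT : IsCompact types := isCompact_Icc
  refine (hT.prod (hT.prod hT)).inter_right ?_
  exact (isClosed_eq (by fun_prop) (by fun_prop)).inter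
    ((isClosed_eq (by fun_prop) (by fun_prop)).inter (isClosed_eq (by fun_prop) (by fun_prop)))

theorem intervalIntegrable_of_continuousOn_unit {g : ℝ → ℝ} (hg : ContinuousOn g (Icc 0 1))
    {x y : ℝ} (hx : x ∈ Icc (0 : ℝ) 1) (hy : y ∈ Icc (0 : ℝ) 1) :
    IntervalIntegrable g volume x y :=
  (hg.mono (ordConnected_Icc.uIcc_subset hx hy)).intervalIntegrable

theorem integral_sub_integral_unit {g : ℝ → ℝ} (hg : ContinuousOn g (Icc 0 1)) {x y : ℝ}
    (hx : x ∈ Icc (0 : ℝ) 1) (hy : y ∈ Icc (0 : ℝ) 1) :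
    (∫ s in (0 : ℝ)..y, g s) - (∫ s in (0 : ℝ)..x, g s) = ∫ s in x..y, g s :=
  have h0 : (0 : ℝ) ∈ Icc (0 : ℝ) 1 := ⟨le_rfl, zero_le_one⟩
  intervalIntegral.integral_interval_sub_left (intervalIntegrable_of_continuousOn_unit hg h0 hy)
    (intervalIntegrable_of_continuousOn_unit hg h0 hx)

theorem hasDerivWithinAt_primitive_unit {g : ℝ → ℝ} (hg : ContinuousOn g (Icc 0 1)) {x : ℝ}
    (hx : x ∈ Icc (0 : ℝ) 1) :
    HasDerivWithinAt (fun y => ∫ s in (0 : ℝ)..y, g s) (g x) (Icc 0 1) x := by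
  set k : ℝ → ℝ := IccExtend zero_le_one ((Icc (0 : ℝ) 1).domRestrict g) with hk
  have hkc : Continuous k := (continuousOn_iff_continuous_domRestrict.1 hg).Icc_extend'
  have hkg : ∀ x ∈ Icc (0 : ℝ) 1, k x = g x := fun x hx => IccExtend_of_mem _ _ hx
  have heq : ∀ y ∈ Icc (0 : ℝ) 1, ∫ s in (0 : ℝ)..y, g s = ∫ s in (0 : ℝ)..y, k s := fun y hy =>
    intervalIntegral.integral_congr fun s hs =>
      (hkg s (ordConnected_Icc.uIcc_subset ⟨le_rfl, zero_le_one⟩ hy hs)).symm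
  have h := (intervalIntegral.integral_hasDerivAt_right (hkc.intervalIntegrable 0 x)
    (hkc.stronglyMeasurableAtFilter _ _) hkc.continuousAt).hasDerivWithinAt (s := Icc 0 1)
  rw [hkg x hx] at h
  exact h.congr heq (heq x hx)

theorem continuousOn_primitive_unit {g : ℝ → ℝ} (hg : ContinuousOn g (Icc 0 1)) :
    ContinuousOn (fun y => ∫ s in (0 : ℝ)..y, g s) (Icc 0 1) :=
  fun _ hx => (hasDerivWithinAt_primitive_unit hg hx).continuousWithinAt

theorem hasDerivWithinAt_of_abs_sub_le {V e : ℝ → ℝ} {k x : ℝ} {s : Set ℝ}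
    (he : ContinuousWithinAt e s x)
    (h : ∀ y ∈ s, |V y - V x - (y - x) * k| ≤ |e y - e x| * |y - x|) :
    HasDerivWithinAt V k s x := by
  rw [hasDerivWithinAt_iff_isLittleO, Asymptotics.isLittleO_iff]
  intro ε hε
  have hcont : Filter.Tendsto (fun y => |e y - e x|) (nhdsWithin x s) (nhds 0) := by
    have := (Filter.Tendsto.sub_const (show Filter.Tendsto e (nhdsWithin x s) (nhds (e x)) from he)
      (e x)).abs
    rwa [sub_self, abs_zero] at this
  filter_upwards [hcont.eventually_lt_const hε, self_mem_nhdsWithin] with y hy hy'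
  exact (h y hy').trans (mul_le_mul_of_nonneg_right hy.le (abs_nonneg _))

namespace MatchingCurve

variable {a b : ℝ} {D U g : ℝ → ℝ}

theorem b_pos (h : MatchingCurve a b D U g) : 0 < b := h.a_pos.trans_le h.a_le

theorem D_mem (h : MatchingCurve a b D U g) {x : ℝ} (hx : x ∈ Icc 0 a) : D x ∈ Icc b 1 := by
  have h0 : (0 : ℝ) ∈ Icc 0 a := ⟨le_rfl, h.a_pos.le⟩
  have ha : a ∈ Icc 0 a := ⟨h.a_pos.le, le_rfl⟩
  rw [← h.D_a, ← h.D_zero]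
  exact ⟨h.D_anti.antitoneOn hx ha hx.2, h.D_anti.antitoneOn h0 hx hx.1⟩

theorem U_D (h : MatchingCurve a b D U g) {x : ℝ} (hx : x ∈ Icc 0 a) : U (D x) = x :=
  h.D_anti.injOn (h.U_mem _ (h.D_mem hx)) hx (h.D_U _ (h.D_mem hx))

theorem U_anti (h : MatchingCurve a b D U g) : AntitoneOn U (Icc b 1) := by
  intro x hx y hy hxy
  by_contra! hlt
  have := h.D_anti (h.U_mem x hx) (h.U_mem y hy) hlt
  rw [h.D_U x hx, h.D_U y hy] at this
  exact absurd hxy (not_le.2 this)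

theorem continuousOn_g (h : MatchingCurve a b D U g) : ContinuousOn g (Icc 0 1) := by
  have h1 : ContinuousOn g (Icc 0 a) := (h.D_cont.pow 2).congr h.g_low
  have h2 : ContinuousOn g (Icc a b) :=
    (continuousOn_const.div continuousOn_id fun x hx => (h.a_pos.trans_le hx.1).ne').congr h.g_mid
  have h3 : ContinuousOn g (Icc b 1) := (continuousOn_id.mul h.U_cont).congr h.g_high
  have h12 := h1.union_of_isClosed h2 isClosed_Icc isClosed_Icc
  rw [Icc_union_Icc_eq_Icc h.a_pos.le h.a_le] at h12
  have h123 := h12.union_of_isClosed h3 isClosed_Icc isClosed_Icc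
  rwa [Icc_union_Icc_eq_Icc h.b_pos.le h.b_lt.le] at h123

theorem unit_cases (x : ℝ) (hx : x ∈ Icc (0 : ℝ) 1) (a b : ℝ) :
    x ∈ Icc 0 a ∨ x ∈ Icc a b ∨ x ∈ Icc b 1 := by
  rcases le_total x a with h | h
  · exact Or.inl ⟨hx.1, h⟩
  rcases le_total x b with h' | h'
  · exact Or.inr (Or.inl ⟨h, h'⟩)
  · exact Or.inr (Or.inr ⟨h', hx.2⟩)

theorem low_mem (h : MatchingCurve a b D U g) {x : ℝ} (hx : x ∈ Icc 0 a) : x ∈ Icc (0 : ℝ) 1 :=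
  ⟨hx.1, hx.2.trans (h.a_le.trans h.b_lt.le)⟩

theorem high_mem (h : MatchingCurve a b D U g) {x : ℝ} (hx : x ∈ Icc b 1) : x ∈ Icc (0 : ℝ) 1 :=
  ⟨h.b_pos.le.trans hx.1, hx.2⟩

theorem mid_mem (h : MatchingCurve a b D U g) {x : ℝ} (hx : x ∈ Icc a b) : x ∈ Icc (0 : ℝ) 1 :=
  ⟨h.a_pos.le.trans hx.1, hx.2.trans h.b_lt.le⟩

theorem low_mem_criticalTeams (h : MatchingCurve a b D U g) {x : ℝ} (hx : x ∈ Icc 0 a) :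
    (x, D x, D x) ∈ criticalTeams g := by
  have hD := h.D_mem hx
  have e : g (D x) = D x * x := by rw [h.g_high _ hD, h.U_D hx]
  refine ⟨⟨h.low_mem hx, h.high_mem hD, h.high_mem hD⟩, ?_, ?_, ?_⟩
  · simp only; rw [h.g_low x hx]; ring
  · simp only; rw [e]; ring
  · simp only; rw [e]; ring

theorem mid_mem_criticalTeams (h : MatchingCurve a b D U g) {x y z : ℝ} (hx : x ∈ Icc a b)
    (hy : y ∈ Icc a b) (hz : z ∈ Icc a b) (hxyz : x * y * z = a * b ^ 2) :
    (x, y, z) ∈ criticalTeams g := by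
  have hx0 := (h.a_pos.trans_le hx.1).ne'
  have hy0 := (h.a_pos.trans_le hy.1).ne'
  have hz0 := (h.a_pos.trans_le hz.1).ne'
  refine ⟨⟨h.mid_mem hx, h.mid_mem hy, h.mid_mem hz⟩, ?_, ?_, ?_⟩
  · simp only; rw [h.g_mid x hx, ← hxyz]; field_simp
  · simp only; rw [h.g_mid y hy, ← hxyz]; field_simp
  · simp only; rw [h.g_mid z hz, ← hxyz]; field_simp

theorem exists_criticalTeam (h : MatchingCurve a b D U g) {x : ℝ} (hx : x ∈ Icc (0 : ℝ) 1) :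
    ∃ y z, (x, y, z) ∈ criticalTeams g := by
  rcases unit_cases x hx a b with hx | hx | hx
  · exact ⟨_, _, h.low_mem_criticalTeams hx⟩
  · have hx0 := h.a_pos.trans_le hx.1
    refine ⟨b, a * b / x, h.mid_mem_criticalTeams hx ⟨h.a_le, le_rfl⟩ ⟨?_, ?_⟩ (by field_simp)⟩
    · rw [le_div_iff₀ hx0]; exact mul_le_mul_of_nonneg_left hx.2 h.a_pos.le
    · rw [div_le_iff₀ hx0, mul_comm]; exact mul_le_mul_of_nonneg_left hx.1 h.b_pos.le
  · have := criticalTeams_rotate (h.low_mem_criticalTeams (h.U_mem x hx))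
    simp only [h.D_U x hx] at this
    exact ⟨_, _, this⟩

theorem loss_le (h : MatchingCurve a b D U g) {x : ℝ} (hx : x ∈ Icc 0 a) :
    x * D x ^ 2 ≤ a * b ^ 2 := by
  have := h.loss_mono hx (⟨h.a_pos.le, le_rfl⟩ : a ∈ Icc 0 a) hx.2
  simpa only [h.D_a] using this

/-- The loss `x g x` at any type `x` is that of a matched team `(r, D r, D r)`, and `x` is a member
of that team unless the loss is maximal. -/
theorem exists_base (h : MatchingCurve a b D U g) {x : ℝ} (hx : x ∈ Icc (0 : ℝ) 1) :
    ∃ r ∈ Icc 0 a, x * g x = r * D r ^ 2 ∧ (x = r ∨ x = D r ∨ x * g x = a * b ^ 2) := by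
  rcases unit_cases x hx a b with hx | hx | hx
  · exact ⟨x, hx, by rw [h.g_low x hx], Or.inl rfl⟩
  · have e : x * g x = a * b ^ 2 := by
      rw [h.g_mid x hx, mul_div_cancel₀ _ (h.a_pos.trans_le hx.1).ne']
    exact ⟨a, ⟨h.a_pos.le, le_rfl⟩, by rw [e, h.D_a], Or.inr (Or.inr e)⟩
  · exact ⟨U x, h.U_mem x hx, by rw [h.g_high x hx, h.D_U x hx]; ring,
      Or.inr (Or.inl (h.D_U x hx).symm)⟩

theorem mul_g_le (h : MatchingCurve a b D U g) {x : ℝ} (hx : x ∈ Icc (0 : ℝ) 1) :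
    x * g x ≤ a * b ^ 2 := by
  obtain ⟨r, hr, e, -⟩ := h.exists_base hx
  rw [e]; exact h.loss_le hr

theorem mul_g_monotoneOn (h : MatchingCurve a b D U g) :
    MonotoneOn (fun x => x * g x) (Icc 0 a) := by
  intro x hx y hy hxy
  simp only [h.g_low x hx, h.g_low y hy]
  exact h.loss_mono hx hy hxy

theorem mul_g_antitoneOn (h : MatchingCurve a b D U g) :
    AntitoneOn (fun x => x * g x) (Icc a 1) := by
  intro x hx y hy hxy
  have hy' : y ∈ Icc (0 : ℝ) 1 := ⟨h.a_pos.le.trans hy.1, hy.2⟩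
  rcases le_total x b with hxb | hxb
  · have : x * g x = a * b ^ 2 := by
      rw [h.g_mid x ⟨hx.1, hxb⟩, mul_div_cancel₀ _ (h.a_pos.trans_le hx.1).ne']
    simp only [this]
    exact h.mul_g_le hy'
  · have hxm : x ∈ Icc b 1 := ⟨hxb, hx.2⟩
    have hym : y ∈ Icc b 1 := ⟨hxb.trans hxy, hy.2⟩
    have e1 : x * g x = U x * D (U x) ^ 2 := by rw [h.g_high x hxm, h.D_U x hxm]; ring
    have e2 : y * g y = U y * D (U y) ^ 2 := by rw [h.g_high y hym, h.D_U y hym]; ring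
    simp only [e1, e2]
    exact h.loss_mono (h.U_mem y hym) (h.U_mem x hxm) (h.U_anti hxm hym hxy)

/-- On the interval where the loss is maximal, the primitive of `g` is logarithmic. -/
theorem primitive_eq_log (h : MatchingCurve a b D U g) {x : ℝ} (hx : x ∈ Icc (0 : ℝ) 1)
    (hxC : x * g x = a * b ^ 2) :
    ∫ s in (0 : ℝ)..x, g s
      = (∫ s in (0 : ℝ)..a, g s) + a * b ^ 2 * (Real.log x - Real.log a) := by
  have ha1 : a ∈ Icc (0 : ℝ) 1 := h.low_mem ⟨h.a_pos.le, le_rfl⟩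
  have hC : 0 < a * b ^ 2 := mul_pos h.a_pos (pow_pos h.b_pos 2)
  have hx0 : 0 < x := by
    rcases hx.1.eq_or_lt with rfl | h0
    · rw [zero_mul] at hxC; exact absurd hxC hC.ne
    · exact h0
  have hflat : ∀ y ∈ uIcc a x, g y = a * b ^ 2 * y⁻¹ := by
    intro y hy
    have hy1 : y ∈ Icc (0 : ℝ) 1 := ordConnected_Icc.uIcc_subset ha1 hx hy
    have hle := h.mul_g_le hy1
    have hge : x * g x ≤ y * g y := by
      rcases le_total a x with hax | hax
      · rw [uIcc_of_le hax] at hy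
        exact h.mul_g_antitoneOn ⟨hy.1, hy1.2⟩ ⟨hax, hx.2⟩ hy.2
      · rw [uIcc_of_ge hax] at hy
        exact h.mul_g_monotoneOn ⟨hx.1, hax⟩ ⟨hy1.1, hy.2⟩ hy.1
    have hyC : y * g y = a * b ^ 2 := le_antisymm hle (hxC ▸ hge)
    have hy0 : y ≠ 0 := by
      rintro rfl
      rw [zero_mul] at hyC; exact absurd hyC hC.ne
    rw [← hyC]; field_simp
  have e := integral_sub_integral_unit h.continuousOn_g ha1 hx
  rw [intervalIntegral.integral_congr hflat, intervalIntegral.integral_const_mul,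
    integral_inv_of_pos h.a_pos hx0, Real.log_div hx0.ne' h.a_pos.ne'] at e
  linarith

/-- The slack along the matching curve changes only to second order, because `g` at each member is
the product of the two other types. -/
theorem abs_slack_sub_le (h : MatchingCurve a b D U g) {x y : ℝ} (hx : x ∈ Icc 0 a)
    (hy : y ∈ Icc 0 a) (hxy : x ≤ y) :
    |slack g y (D y) (D y) - slack g x (D x) (D x)| ≤ (y - x) * (D x ^ 2 - D y ^ 2) := by
  have hc := h.continuousOn_g
  have hDx := h.D_mem hx
  have hDy := h.D_mem hy
  have hD : D y ≤ D x := h.D_anti.antitoneOn hx hy hxy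
  have hDy0 : 0 ≤ D y := h.b_pos.le.trans hDy.1
  have e1 := integral_sub_integral_unit hc (h.low_mem hx) (h.low_mem hy)
  have e2 := integral_sub_integral_unit hc (h.high_mem hDy) (h.high_mem hDx)
  have hi1 := intervalIntegrable_of_continuousOn_unit hc (h.low_mem hx) (h.low_mem hy)
  have hi2 := intervalIntegrable_of_continuousOn_unit hc (h.high_mem hDy) (h.high_mem hDx)
  have b1 : (y - x) * D y ^ 2 ≤ ∫ s in x..y, g s := by
    have := intervalIntegral.integral_mono_on hxy (intervalIntegrable_const (c := D y ^ 2)) hi1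
      fun s hs => by
        have hs' : s ∈ Icc 0 a := ⟨hx.1.trans hs.1, hs.2.trans hy.2⟩
        rw [h.g_low s hs']
        exact pow_le_pow_left₀ hDy0 (h.D_anti.antitoneOn hs' hy hs.2) 2
    simpa using this
  have b2 : ∫ s in x..y, g s ≤ (y - x) * D x ^ 2 := by
    have := intervalIntegral.integral_mono_on hxy hi1 (intervalIntegrable_const (c := D x ^ 2))
      fun s hs => by
        have hs' : s ∈ Icc 0 a := ⟨hx.1.trans hs.1, hs.2.trans hy.2⟩
        rw [h.g_low s hs']
        exact pow_le_pow_left₀ (h.b_pos.le.trans (h.D_mem hs').1)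
          (h.D_anti.antitoneOn hx hs' hs.1) 2
    simpa using this
  have hlin : ∀ k : ℝ, IntervalIntegrable (fun s : ℝ => s * k) volume (D y) (D x) := fun k =>
    Continuous.intervalIntegrable (by fun_prop) _ _
  have hval : ∀ k : ℝ, ∫ s in (D y)..(D x), s * k = (D x ^ 2 - D y ^ 2) / 2 * k := fun k => by
    rw [intervalIntegral.integral_mul_const, integral_id]
  have hU : ∀ s ∈ Icc (D y) (D x), g s = s * U s ∧ x ≤ U s ∧ U s ≤ y ∧ 0 ≤ s := by
    intro s hs
    have hs' : s ∈ Icc b 1 := ⟨hDy.1.trans hs.1, hs.2.trans hDx.2⟩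
    refine ⟨h.g_high s hs', ?_, ?_, hDy0.trans hs.1⟩
    · have := h.U_anti hs' hDx hs.2; rwa [h.U_D hx] at this
    · have := h.U_anti hDy hs' hs.1; rwa [h.U_D hy] at this
  have b3 : (D x ^ 2 - D y ^ 2) / 2 * x ≤ ∫ s in (D y)..(D x), g s := by
    rw [← hval]
    refine intervalIntegral.integral_mono_on hD (hlin x) hi2 fun s hs => ?_
    obtain ⟨e, h1, -, h3⟩ := hU s hs
    rw [e]; exact mul_le_mul_of_nonneg_left h1 h3
  have b4 : ∫ s in (D y)..(D x), g s ≤ (D x ^ 2 - D y ^ 2) / 2 * y := by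
    rw [← hval]
    refine intervalIntegral.integral_mono_on hD hi2 (hlin y) fun s hs => ?_
    obtain ⟨e, -, h2, h3⟩ := hU s hs
    rw [e]; exact mul_le_mul_of_nonneg_left h2 h3
  have key : slack g y (D y) (D y) - slack g x (D x) (D x)
      = y * D y ^ 2 - x * D x ^ 2 - (∫ s in x..y, g s) + 2 * ∫ s in (D y)..(D x), g s := by
    rw [← e1, ← e2]; simp only [slack]; ring
  rw [key, abs_le]
  constructor
  · linarith
  · linarith

/-- All teams on the matching curve have the same slack. As `D` need not be differentiable, the
first order conditions enter through the second order bound `abs_slack_sub_le`. -/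
theorem slack_low (h : MatchingCurve a b D U g) {x : ℝ} (hx : x ∈ Icc 0 a) :
    slack g x (D x) (D x) = slack g a b b := by
  set V : ℝ → ℝ := fun x => slack g x (D x) (D x) with hV
  have hbound : ∀ x ∈ Icc 0 a, ∀ y ∈ Icc 0 a, |V y - V x| ≤ |D y ^ 2 - D x ^ 2| * |y - x| := by
    intro x hx y hy
    rcases le_total x y with hxy | hxy
    · rw [abs_of_nonneg (sub_nonneg.2 hxy), abs_sub_comm (D y ^ 2), mul_comm]
      exact (h.abs_slack_sub_le hx hy hxy).trans
        (mul_le_mul_of_nonneg_left (le_abs_self _) (sub_nonneg.2 hxy))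
    · rw [abs_sub_comm (V y), abs_sub_comm y, abs_of_nonneg (sub_nonneg.2 hxy), mul_comm]
      exact (h.abs_slack_sub_le hy hx hxy).trans
        (mul_le_mul_of_nonneg_left (le_abs_self _) (sub_nonneg.2 hxy))
  have hder : ∀ x ∈ Icc 0 a, HasDerivWithinAt V 0 (Icc 0 a) x := fun x hx =>
    hasDerivWithinAt_of_abs_sub_le ((h.D_cont.pow 2) x hx) fun y hy => by
      simpa using hbound x hx y hy
  have hconst := constant_of_derivWithin_zero (fun y hy => (hder y hy).differentiableWithinAt)
    (fun y hy => (hder y (Ico_subset_Icc_self hy)).derivWithin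
      (uniqueDiffOn_Icc h.a_pos y (Ico_subset_Icc_self hy)))
  have e1 := hconst x hx
  have e2 := hconst a ⟨h.a_pos.le, le_rfl⟩
  rw [← e2] at e1
  simpa only [hV, h.D_a] using e1

theorem slack_comm (g : ℝ → ℝ) (x y z : ℝ) : slack g y z x = slack g x y z := by
  simp only [slack]; ring

/-- All critical teams have the same slack: either they lie on the matching curve, or they have
the maximal loss and the primitive of `g` is logarithmic at their members. -/
theorem slack_criticalTeams (h : MatchingCurve a b D U g) {x y z : ℝ}
    (ht : (x, y, z) ∈ criticalTeams g) : slack g x y z = slack g a b b := by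
  obtain ⟨⟨hx, hy, hz⟩, ex, ey, ez⟩ := ht
  simp only at hx hy hz ex ey ez
  have hxl : x * g x = x * y * z := by rw [← ex]; ring
  have hyl : y * g y = x * y * z := by rw [← ey]; ring
  have hzl : z * g z = x * y * z := by rw [← ez]; ring
  have ha : a ∈ Icc 0 a := ⟨h.a_pos.le, le_rfl⟩
  have hC : 0 < a * b ^ 2 := mul_pos h.a_pos (pow_pos h.b_pos 2)
  rcases (h.mul_g_le hx).eq_or_lt with hmax | hlt
  · -- maximal loss
    have hb : b * g b = a * b ^ 2 := by
      rw [h.g_mid b ⟨h.a_le, le_rfl⟩, mul_div_cancel₀ _ h.b_pos.ne']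
    have hprod : x * y * z = a * b ^ 2 := hxl ▸ hmax
    have hpos : 0 < x * y * z := hprod ▸ hC
    have hx0 : x ≠ 0 := by rintro rfl; simp at hpos
    have hy0 : y ≠ 0 := by rintro rfl; simp at hpos
    have hz0 : z ≠ 0 := by rintro rfl; simp at hpos
    have hlog : Real.log x + Real.log y + Real.log z = Real.log a + 2 * Real.log b := by
      rw [← Real.log_mul hx0 hy0, ← Real.log_mul (mul_ne_zero hx0 hy0) hz0, hprod,
        Real.log_mul h.a_pos.ne' (pow_pos h.b_pos 2).ne', Real.log_pow]
      norm_num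
    simp only [slack]
    rw [h.primitive_eq_log hx hmax, h.primitive_eq_log hy (by rw [hyl, hprod]),
      h.primitive_eq_log hz (by rw [hzl, hprod]),
      h.primitive_eq_log (h.high_mem ⟨le_rfl, h.b_lt.le⟩) hb, hprod]
    linear_combination (-(a * b ^ 2)) * hlog
  · -- the members share a base type `r`
    obtain ⟨r, hr, hrx, hx'⟩ := h.exists_base hx
    obtain ⟨r₂, hr₂, hry, hy'⟩ := h.exists_base hy
    obtain ⟨r₃, hr₃, hrz, hz'⟩ := h.exists_base hz
    have hinj : ∀ s ∈ Icc 0 a, s * D s ^ 2 = r * D r ^ 2 → s = r := by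
      intro s hs e
      rcases lt_trichotomy s r with hsr | hsr | hsr
      · exact absurd (h.loss_flat s r hs.1 hsr hr.2 e) (by rw [← hrx]; exact hlt.ne)
      · exact hsr
      · exact absurd (h.loss_flat r s hr.1 hsr hs.2 e.symm) (by rw [e, ← hrx]; exact hlt.ne)
    obtain rfl : r₂ = r := hinj r₂ hr₂ (by rw [← hry, ← hrx, hxl, hyl])
    obtain rfl : r₃ = r₂ := hinj r₃ hr₃ (by rw [← hrz, ← hrx, hxl, hzl])
    have hxx : x = r₃ ∨ x = D r₃ := by
      rcases hx' with e | e | e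
      · exact Or.inl e
      · exact Or.inr e
      · exact absurd e hlt.ne
    have hyy : y = r₃ ∨ y = D r₃ := by
      rcases hy' with e | e | e
      · exact Or.inl e
      · exact Or.inr e
      · exact absurd (hxl.trans (hyl.symm.trans e)) hlt.ne
    have hzz : z = r₃ ∨ z = D r₃ := by
      rcases hz' with e | e | e
      · exact Or.inl e
      · exact Or.inr e
      · exact absurd (hxl.trans (hzl.symm.trans e)) hlt.ne
    have hra : r₃ < a := lt_of_le_of_ne hr₃.2 (by
      rintro rfl
      rw [h.D_a] at hrx
      exact hlt.ne hrx)
    have hDr : b < D r₃ := h.D_a ▸ h.D_anti hr₃ ha hra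
    have hrD : r₃ < D r₃ := hra.trans_le (h.a_le.trans hDr.le)
    have hD0 : 0 < D r₃ := h.b_pos.trans hDr
    have glow := h.g_low r₃ hr₃
    have ghigh : g (D r₃) = D r₃ * r₃ := by rw [h.g_high _ (h.D_mem hr₃), h.U_D hr₃]
    -- a member `r` forces the two others to be `D r`, and not all three can be `D r`
    have hrr : r₃ * r₃ ≠ D r₃ ^ 2 := by
      intro e; nlinarith [hr₃.1]
    have hrD2 : r₃ * D r₃ ≠ D r₃ ^ 2 := by
      intro e; nlinarith
    have hDD : D r₃ * D r₃ ≠ D r₃ * r₃ := by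
      intro e; nlinarith
    rw [← h.slack_low hr₃]
    rcases hxx with rfl | rfl <;> rcases hyy with rfl | rfl <;> rcases hzz with rfl | rfl
    all_goals first
      | rfl
      | exact slack_comm _ _ _ _
      | exact (slack_comm _ _ _ _).symm
      | (exfalso; first
          | exact hrr (ex.trans glow)
          | exact hrD2 (ex.trans glow)
          | exact hrD2 (((mul_comm _ _).trans ex).trans glow)
          | exact hrD2 (((mul_comm _ _).trans ey).trans glow)
          | exact hDD (ex.trans ghigh))

/-- The primitive of `g` is dual feasible up to a constant: at a minimum of the slack over the cube
the first order conditions hold, also on the boundary since `g 0 = 1` and `g 1 = 0`. -/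
theorem slack_ge (h : MatchingCurve a b D U g) {x y z : ℝ} (hx : x ∈ Icc (0 : ℝ) 1)
    (hy : y ∈ Icc (0 : ℝ) 1) (hz : z ∈ Icc (0 : ℝ) 1) : slack g a b b ≤ slack g x y z := by
  have hg0 : g 0 = 1 := by rw [h.g_low 0 ⟨le_rfl, h.a_pos.le⟩, h.D_zero]; norm_num
  have hU1 : U 1 = 0 := by rw [← h.D_zero]; exact h.U_D ⟨le_rfl, h.a_pos.le⟩
  have hg1 : g 1 = 0 := by rw [h.g_high 1 ⟨h.b_lt.le, le_rfl⟩, hU1, mul_zero]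
  -- the first order condition in one variable
  have foc : ∀ x ∈ Icc (0 : ℝ) 1, ∀ k ∈ Icc (0 : ℝ) 1,
      (∀ y ∈ Icc (0 : ℝ) 1, x * k - (∫ s in (0 : ℝ)..x, g s) ≤ y * k - ∫ s in (0 : ℝ)..y, g s) →
      k = g x := by
    intro x hx k hk hmin
    have hd : HasDerivWithinAt (fun y => y * k - ∫ s in (0 : ℝ)..y, g s) (k - g x) (Icc 0 1) x := by
      have := ((hasDerivWithinAt_id x (Icc (0 : ℝ) 1)).mul_const k).fun_sub
        (hasDerivWithinAt_primitive_unit h.continuousOn_g hx)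
      simpa using this
    have hvar : ∀ y ∈ Icc (0 : ℝ) 1, 0 ≤ (y - x) * (k - g x) := by
      intro y hy
      have hloc : IsLocalMinOn (fun y => y * k - ∫ s in (0 : ℝ)..y, g s) (Icc 0 1) x :=
        IsMinOn.localize (fun y hy => hmin y hy)
      have := hloc.hasFDerivWithinAt_nonneg hd.hasFDerivWithinAt
        (sub_mem_posTangentConeAt_of_segment_subset ((convex_Icc (0 : ℝ) 1).segment_subset hx hy))
      simpa using this
    have h1 := hvar 1 ⟨zero_le_one, le_rfl⟩
    have h0 := hvar 0 ⟨le_rfl, zero_le_one⟩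
    rcases hx.1.eq_or_lt with rfl | hx0
    · rw [hg0] at h1 ⊢
      nlinarith [hk.2]
    rcases hx.2.eq_or_lt with rfl | hx1
    · rw [hg1] at h0 ⊢
      nlinarith [hk.1]
    refine le_antisymm ?_ ?_
    · nlinarith
    · nlinarith
  have hT : IsCompact ((Icc (0 : ℝ) 1) ×ˢ (Icc (0 : ℝ) 1) ×ˢ (Icc (0 : ℝ) 1)) :=
    isCompact_Icc.prod (isCompact_Icc.prod isCompact_Icc)
  have hP := continuousOn_primitive_unit h.continuousOn_g
  have hcont : ContinuousOn (fun t : ℝ × ℝ × ℝ => slack g t.1 t.2.1 t.2.2)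
      ((Icc (0 : ℝ) 1) ×ˢ (Icc (0 : ℝ) 1) ×ˢ (Icc (0 : ℝ) 1)) := by
    have c1 := hP.comp (s := (Icc (0 : ℝ) 1) ×ˢ (Icc (0 : ℝ) 1) ×ˢ (Icc (0 : ℝ) 1))
      (f := fun t : ℝ × ℝ × ℝ => t.1) (by fun_prop) fun t ht => ht.1
    have c2 := hP.comp (s := (Icc (0 : ℝ) 1) ×ˢ (Icc (0 : ℝ) 1) ×ˢ (Icc (0 : ℝ) 1))
      (f := fun t : ℝ × ℝ × ℝ => t.2.1) (by fun_prop) fun t ht => ht.2.1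
    have c3 := hP.comp (s := (Icc (0 : ℝ) 1) ×ˢ (Icc (0 : ℝ) 1) ×ˢ (Icc (0 : ℝ) 1))
      (f := fun t : ℝ × ℝ × ℝ => t.2.2) (by fun_prop) fun t ht => ht.2.2
    exact (((by fun_prop : Continuous fun t : ℝ × ℝ × ℝ => t.1 * t.2.1 * t.2.2).continuousOn.sub
      c1).sub c2).sub c3
  obtain ⟨⟨x₀, y₀, z₀⟩, ⟨hx₀, hy₀, hz₀⟩, hmin⟩ := hT.exists_isMinOn ⟨(x, y, z), hx, hy, hz⟩ hcont
  simp only at hx₀ hy₀ hz₀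
  have hmin' : ∀ x ∈ Icc (0 : ℝ) 1, ∀ y ∈ Icc (0 : ℝ) 1, ∀ z ∈ Icc (0 : ℝ) 1,
      slack g x₀ y₀ z₀ ≤ slack g x y z := fun x hx y hy z hz =>
    hmin (show (x, y, z) ∈ _ from ⟨hx, hy, hz⟩)
  have hmul : ∀ {x y : ℝ}, x ∈ Icc (0 : ℝ) 1 → y ∈ Icc (0 : ℝ) 1 → x * y ∈ Icc (0 : ℝ) 1 :=
    fun hx hy => ⟨mul_nonneg hx.1 hy.1, mul_le_one₀ hx.2 hy.1 hy.2⟩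
  have hcrit : (x₀, y₀, z₀) ∈ criticalTeams g := by
    refine ⟨⟨hx₀, hy₀, hz₀⟩, ?_, ?_, ?_⟩
    · refine foc x₀ hx₀ _ (hmul hy₀ hz₀) fun s hs => ?_
      have := hmin' s hs y₀ hy₀ z₀ hz₀
      simp only [slack] at this; linarith
    · refine foc y₀ hy₀ _ (hmul hx₀ hz₀) fun s hs => ?_
      have := hmin' x₀ hx₀ s hs z₀ hz₀
      simp only [slack] at this; linarith
    · refine foc z₀ hz₀ _ (hmul hx₀ hy₀) fun s hs => ?_
      have := hmin' x₀ hx₀ y₀ hy₀ s hs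
      simp only [slack] at this; linarith
  rw [← h.slack_criticalTeams hcrit]
  exact hmin' x hx y hy z hz

end MatchingCurve

/-! ### Assignments to critical teams -/

theorem IsTypeDistribution.cdf_mem_Icc (hμ : IsTypeDistribution μ f) {p q x : ℝ}
    (hp : p ∈ Icc (0 : ℝ) 1) (hq : q ∈ Icc (0 : ℝ) 1) (hx : x ∈ Icc (quantile μ p) (quantile μ q)) :
    cdf μ x ∈ Icc p q := by
  have h1 := monotone_cdf μ hx.1
  have h2 := monotone_cdf μ hx.2
  rw [hμ.cdf_quantile hp] at h1
  rw [hμ.cdf_quantile hq] at h2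
  exact ⟨h1, h2⟩

/-- Under concavity of the logarithmic loss, the losses of the teams `(I(p), I(1-2p), I(1-2p))` and
the negative of the marginal product form a matching curve. -/
theorem IsTypeDistribution.matchingCurve (hμ : IsTypeDistribution μ f) (hpl : IsLowerCutoff μ pl)
    (hconc : ConcaveOn ℝ (Ioc 0 (1 / 3)) (logLoss μ)) :
    MatchingCurve (quantile μ pl) (quantile μ (1 - 2 * pl)) (fun x => quantile μ (1 - 2 * cdf μ x))
      (fun y => quantile μ ((1 - cdf μ y) / 2)) (fun x => -marginalProduct μ pl x) := by
  obtain ⟨hpl0, hpl3⟩ := hpl.mem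
  have m0 : (0 : ℝ) ∈ Icc (0 : ℝ) 1 := ⟨le_rfl, zero_le_one⟩
  have m1 : (1 : ℝ) ∈ Icc (0 : ℝ) 1 := ⟨zero_le_one, le_rfl⟩
  have mpl : pl ∈ Icc (0 : ℝ) 1 := ⟨hpl0.le, by linarith⟩
  have mpu : 1 - 2 * pl ∈ Icc (0 : ℝ) 1 := ⟨by linarith, by linarith⟩
  have ha0 := hμ.quantile_pos hpl0 mpl.2
  have hb0 := hμ.quantile_pos (p := 1 - 2 * pl) (by linarith) mpu.2
  have ha1 := (hμ.quantile_mem mpl).2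
  have hb1 := (hμ.quantile_mem mpu).2
  have clow : ∀ x ∈ Icc 0 (quantile μ pl), cdf μ x ∈ Icc 0 pl := fun x hx =>
    hμ.cdf_mem_Icc m0 mpl (by rwa [hμ.quantile_zero])
  have chigh : ∀ x ∈ Icc (quantile μ (1 - 2 * pl)) 1, cdf μ x ∈ Icc (1 - 2 * pl) 1 := fun x hx =>
    hμ.cdf_mem_Icc mpu m1 (by rwa [hμ.quantile_one])
  have cmid : ∀ x ∈ Icc (quantile μ pl) (quantile μ (1 - 2 * pl)),
      cdf μ x ∈ Icc pl (1 - 2 * pl) := fun x hx => hμ.cdf_mem_Icc mpl mpu hx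
  have hC : Real.exp (logLoss μ pl) = quantile μ pl * quantile μ (1 - 2 * pl) ^ 2 := by
    rw [hμ.exp_logLoss hpl.mem, mul_comm]
  have hloss : ∀ x ∈ Icc 0 (quantile μ pl), 0 < x → cdf μ x ∈ Ioc 0 pl ∧
      x * quantile μ (1 - 2 * cdf μ x) ^ 2 = Real.exp (logLoss μ (cdf μ x)) := by
    intro x hx hx0
    have h1 : 0 < cdf μ x := by
      have := hμ.cdf_strictMono m0 ⟨hx.1, hx.2.trans ha1⟩ hx0
      rwa [hμ.cdf_zero] at this
    refine ⟨⟨h1, (clow x hx).2⟩, ?_⟩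
    rw [hμ.exp_logLoss ⟨h1, (clow x hx).2.trans hpl3⟩, hμ.quantile_cdf ⟨hx.1, hx.2.trans ha1⟩,
      mul_comm]
  refine
    { a_pos := ha0
      a_le := hμ.quantile_mono hpl0.le (by linarith) mpu.2
      b_lt := hμ.quantile_lt_one mpu.1 (by linarith)
      D_anti := ?_
      D_cont := ?_
      D_zero := ?_
      D_a := ?_
      U_mem := ?_
      D_U := ?_
      U_cont := ?_
      g_low := ?_
      g_mid := ?_
      g_high := ?_
      loss_mono := ?_
      loss_flat := ?_ }
  · intro x hx y hy hxy
    have h1 := hμ.cdf_strictMono ⟨hx.1, hx.2.trans ha1⟩ ⟨hy.1, hy.2.trans ha1⟩ hxy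
    have hx' := clow x hx
    have hy' := clow y hy
    exact hμ.quantile_strictMono ⟨by linarith [hy'.2], by linarith [hy'.1]⟩
      ⟨by linarith [hx'.2], by linarith [hx'.1]⟩ (by linarith)
  · exact hμ.continuousOn_quantile.comp
      (by have := hμ.continuous_cdf; fun_prop : Continuous fun x => 1 - 2 * cdf μ x).continuousOn
      fun x hx => ⟨by linarith [(clow x hx).2], by linarith [(clow x hx).1]⟩
  · simp only [hμ.cdf_zero, mul_zero, sub_zero, hμ.quantile_one]
  · simp only [hμ.cdf_quantile mpl]
  · intro y hy
    have hy' := chigh y hy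
    refine ⟨(hμ.quantile_mem ⟨by linarith [hy'.2], by linarith [hy'.1]⟩).1, ?_⟩
    exact hμ.quantile_mono (by linarith [hy'.2]) (by linarith [hy'.1]) mpl.2
  · intro y hy
    have hy' := chigh y hy
    rw [hμ.cdf_quantile ⟨by linarith [hy'.2], by linarith [hy'.1]⟩,
      show 1 - 2 * ((1 - cdf μ y) / 2) = cdf μ y by ring,
      hμ.quantile_cdf ⟨hb0.le.trans hy.1, hy.2⟩]
  · exact hμ.continuousOn_quantile.comp
      (by have := hμ.continuous_cdf; fun_prop : Continuous fun x => (1 - cdf μ x) / 2).continuousOn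
      fun x hx => ⟨by linarith [(chigh x hx).2], by linarith [(chigh x hx).1]⟩
  · intro x hx
    simp only [marginalProduct, if_pos (clow x hx).2, neg_neg]
  · intro x hx
    have hx' := cmid x hx
    have hxm : x ∈ Icc (0 : ℝ) 1 := ⟨ha0.le.trans hx.1, hx.2.trans hb1⟩
    simp only [marginalProduct]
    split_ifs with h1 h2
    · have hxe : x = quantile μ pl := by
        rw [← le_antisymm h1 hx'.1, hμ.quantile_cdf hxm]
      rw [le_antisymm h1 hx'.1, hxe]; field_simp
    · have hc : CutoffEquation μ pl := by
        rcases hpl with h | h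
        · exact h.2
        · exfalso; linarith [h.1]
      rw [hc, hμ.quantile_cdf hxm, neg_neg, mul_comm]
    · have hxe : x = quantile μ (1 - 2 * pl) := by
        rw [← le_antisymm hx'.2 (not_lt.1 h2), hμ.quantile_cdf hxm]
      rw [hμ.quantile_cdf hxm, le_antisymm hx'.2 (not_lt.1 h2), hxe,
        show (1 - (1 - 2 * pl)) / 2 = pl by ring]
      field_simp
  · intro x hx
    have hx' := chigh x hx
    have hxm : x ∈ Icc (0 : ℝ) 1 := ⟨hb0.le.trans hx.1, hx.2⟩
    simp only [marginalProduct]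
    split_ifs with h1 h2
    · -- here the cutoff is `1/3` and `x = I(1/3)`
      have e1 : 1 - 2 * cdf μ x = cdf μ x := by linarith [hx'.1]
      have e2 : (1 - cdf μ x) / 2 = cdf μ x := by linarith [hx'.1]
      rw [e1, e2, hμ.quantile_cdf hxm]; ring
    · exact absurd h2 (not_lt.2 hx'.1)
    · rw [hμ.quantile_cdf hxm, neg_neg]
  · intro x hx y hy hxy
    rcases hx.1.eq_or_lt with rfl | hx0
    · simp only [zero_mul]
      exact mul_nonneg hy.1 (sq_nonneg _)
    · obtain ⟨cx, ex⟩ := hloss x hx hx0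
      obtain ⟨cy, ey⟩ := hloss y hy (hx0.trans_le hxy)
      simp only [ex, ey]
      exact Real.exp_le_exp.2 (hμ.logLoss_monotoneOn hpl hconc cx cy (monotone_cdf μ hxy))
  · intro x y hx hxy hy he
    obtain ⟨cy, ey⟩ := hloss y ⟨hx.trans hxy.le, hy⟩ (hx.trans_lt hxy)
    rcases hx.eq_or_lt with rfl | hx0
    · simp only [ey, zero_mul] at he
      exact absurd he (Real.exp_pos _).ne
    · obtain ⟨cx, ex⟩ := hloss x ⟨hx, hxy.le.trans hy⟩ hx0
      simp only [ex, ey] at he ⊢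
      rw [hμ.logLoss_eq_cutoff_of_eq hpl hconc cx.1
        (hμ.cdf_strictMono ⟨hx, (hxy.le.trans hy).trans ha1⟩ ⟨hx.trans hxy.le, hy.trans ha1⟩ hxy)
        cy.2 (Real.exp_injective he), hC]

/-- Substitution `I(p) = b e^{-u}` on the mixed middle. -/
theorem IsTypeDistribution.integral_middle (hμ : IsTypeDistribution μ f) {a b : ℝ} (ha : 0 < a)
    (hab : a ≤ b) (hb : b < 1) {ψ : ℝ → ℝ} (hψ : ContinuousOn ψ (Icc a b)) :
    ∫ p in cdf μ a..cdf μ b, ψ (quantile μ p) = ∫ u in (0 : ℝ)..(Real.log b - Real.log a),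
      ψ (b * Real.exp (-u)) * (b * Real.exp (-u) * f (b * Real.exp (-u))) := by
  have hb0 := ha.trans_le hab
  rw [hμ.integral_comp_quantile ha hab hb hψ]
  set c := Real.log b - Real.log a with hc
  have hc0 : 0 ≤ c := sub_nonneg.2 (Real.log_le_log ha hab)
  have hφc : b * Real.exp (-c) = a := by
    rw [hc, neg_sub, Real.exp_sub, Real.exp_log ha, Real.exp_log hb0]; field_simp
  have hmaps : (fun u => b * Real.exp (-u)) '' uIcc 0 c ⊆ Icc a b := by
    rw [uIcc_of_le hc0]
    rintro _ ⟨u, hu, rfl⟩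
    refine ⟨?_, ?_⟩
    · rw [← hφc]
      exact mul_le_mul_of_nonneg_left (Real.exp_le_exp.2 (neg_le_neg hu.2)) hb0.le
    · exact mul_le_of_le_one_right hb0.le (Real.exp_le_one_iff.2 (neg_nonpos.2 hu.1))
  have hψf : ContinuousOn (fun x => ψ x * f x) (Icc a b) :=
    hψ.mul (hμ.density_continuous.mono fun x hx => ⟨ha.trans_le hx.1, hx.2.trans_lt hb⟩)
  have hder : ∀ u : ℝ, HasDerivAt (fun u => b * Real.exp (-u)) (-(b * Real.exp (-u))) u :=
      fun u => by
    have := ((hasDerivAt_neg u).exp).const_mul b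
    simpa using this
  have hsub := intervalIntegral.integral_comp_mul_deriv'' (a := 0) (b := c)
    (f := fun u => b * Real.exp (-u)) (f' := fun u => -(b * Real.exp (-u)))
    (g := fun x => ψ x * f x) (by fun_prop) (fun u _ => (hder u).hasDerivWithinAt) (by fun_prop)
    (hψf.mono hmaps)
  simp only [Function.comp_apply, neg_zero, Real.exp_zero, mul_one, hφc] at hsub
  rw [intervalIntegral.integral_symm, ← hsub, ← intervalIntegral.integral_neg]
  refine intervalIntegral.integral_congr fun u _ => ?_
  ring

/-- The middle types can be mixed into teams of constant loss, in dual form. -/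
theorem IsTypeDistribution.integral_middle_nonneg (hμ : IsTypeDistribution μ f)
    (hpl : IsLowerCutoff μ pl)
    (hmono : MonotoneOn (fun x => x * f x) (Icc (quantile μ pl) (quantile μ (1 - 2 * pl))))
    {α : ℝ → ℝ} (hα : Continuous α)
    (h : ∀ x ∈ Icc (quantile μ pl) (quantile μ (1 - 2 * pl)),
      ∀ y ∈ Icc (quantile μ pl) (quantile μ (1 - 2 * pl)),
      ∀ z ∈ Icc (quantile μ pl) (quantile μ (1 - 2 * pl)),
      x * y * z = quantile μ pl * quantile μ (1 - 2 * pl) ^ 2 → 0 ≤ α x + α y + α z) :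
    0 ≤ ∫ p in pl..(1 - 2 * pl), α (quantile μ p) := by
  obtain ⟨hpl0, hpl3⟩ := hpl.mem
  rcases hpl3.eq_or_lt with he | hlt
  · rw [show 1 - 2 * pl = pl by linarith, intervalIntegral.integral_same]
  have mpl : pl ∈ Icc (0 : ℝ) 1 := ⟨hpl0.le, by linarith⟩
  have mpu : 1 - 2 * pl ∈ Icc (0 : ℝ) 1 := ⟨by linarith, by linarith⟩
  have ha0 := hμ.quantile_pos hpl0 mpl.2
  have hab := hμ.quantile_strictMono mpl mpu (by linarith)
  have hb1 := hμ.quantile_lt_one mpu.1 (by linarith)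
  have hcut := hμ.integral_logLoss_cutoff hpl
  have hca := hμ.cdf_quantile mpl
  have hcb := hμ.cdf_quantile mpu
  rw [logLoss] at hcut
  set a := quantile μ pl
  set b := quantile μ (1 - 2 * pl)
  have hb0 := ha0.trans hab
  set c := Real.log b - Real.log a with hc
  have hc0 : 0 < c := sub_pos.2 (Real.log_lt_log ha0 hab)
  have hφc : b * Real.exp (-c) = a := by
    rw [hc, neg_sub, Real.exp_sub, Real.exp_log ha0, Real.exp_log hb0]; field_simp
  have hmaps : ∀ u ∈ Icc 0 c, b * Real.exp (-u) ∈ Icc a b := by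
    intro u hu
    refine ⟨?_, ?_⟩
    · rw [← hφc]
      exact mul_le_mul_of_nonneg_left (Real.exp_le_exp.2 (neg_le_neg hu.2)) hb0.le
    · exact mul_le_of_le_one_right hb0.le (Real.exp_le_one_iff.2 (neg_nonpos.2 hu.1))
  have hsub : Icc a b ⊆ Ioo 0 1 := fun x hx => ⟨ha0.trans_le hx.1, hx.2.trans_lt hb1⟩
  have hint : ∀ ψ : ℝ → ℝ, ContinuousOn ψ (Icc a b) →
      ∫ p in pl..(1 - 2 * pl), ψ (quantile μ p) = ∫ u in (0 : ℝ)..c,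
        ψ (b * Real.exp (-u)) * (b * Real.exp (-u) * f (b * Real.exp (-u))) := fun ψ hψ => by
    have := hμ.integral_middle ha0 hab.le hb1 hψ
    rwa [hca, hcb] at this
  rw [hint α hα.continuousOn]
  refine integral_mul_nonneg_of_simplex hc0 (β := fun u => α (b * Real.exp (-u)))
    (κ := fun u => b * Real.exp (-u) * f (b * Real.exp (-u))) (by fun_prop) ?_ ?_ ?_ ?_ ?_
  · intro u₁ u₂ u₃ h1 h2 h3 hsum
    refine h _ (hmaps u₁ ⟨h1, by linarith⟩) _ (hmaps u₂ ⟨h2, by linarith⟩) _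
      (hmaps u₃ ⟨h3, by linarith⟩) ?_
    have : Real.exp (-u₁) * Real.exp (-u₂) * Real.exp (-u₃) = Real.exp (-c) := by
      rw [← Real.exp_add, ← Real.exp_add]; congr 1; linarith
    rw [← hφc, ← this]; ring
  · exact (by fun_prop : ContinuousOn (fun u : ℝ => b * Real.exp (-u)) (Icc 0 c)).mul
      (hμ.density_continuous.comp (f := fun u : ℝ => b * Real.exp (-u)) (by fun_prop)
        fun u hu => hsub (hmaps u hu))
  · intro u hu v hv huv
    exact hmono (hmaps v hv) (hmaps u hu)
      (mul_le_mul_of_nonneg_left (Real.exp_le_exp.2 (neg_le_neg huv)) hb0.le)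
  · exact fun u hu => mul_nonneg (mul_nonneg hb0.le (Real.exp_pos _).le)
      (hμ.density_nonneg _ (hsub (hmaps u hu)))
  · -- the mean condition is the cutoff equation
    have hlogc : ContinuousOn (fun x => Real.log b - Real.log x - c / 3) (Icc a b) :=
      (continuousOn_const.sub (continuousOn_id.log fun x hx => (ha0.trans_le hx.1).ne')).sub
        continuousOn_const
    have e := hint _ hlogc
    have hli : IntervalIntegrable (fun p => Real.log (quantile μ p)) volume pl (1 - 2 * pl) :=
      (hμ.continuousOn_log_quantile.mono fun p hp =>
        ⟨hpl0.trans_le hp.1, hp.2.trans mpu.2⟩).intervalIntegrable_of_Icc (by linarith)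
    have e2 : ∫ p in pl..(1 - 2 * pl), (Real.log b - Real.log (quantile μ p) - c / 3)
        = (1 - 3 * pl) * (Real.log b - c / 3)
          - ∫ p in pl..(1 - 2 * pl), Real.log (quantile μ p) := by
      rw [show (fun p => Real.log b - Real.log (quantile μ p) - c / 3)
          = fun p => (Real.log b - c / 3) - Real.log (quantile μ p) by ext p; ring,
        intervalIntegral.integral_sub intervalIntegrable_const hli,
        intervalIntegral.integral_const, smul_eq_mul]
      ring
    rw [e2, hcut] at e
    have e3 : ∫ u in (0 : ℝ)..c, (u - c / 3) * (b * Real.exp (-u) * f (b * Real.exp (-u)))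
        = ∫ u in (0 : ℝ)..c, (Real.log b - Real.log (b * Real.exp (-u)) - c / 3)
          * (b * Real.exp (-u) * f (b * Real.exp (-u))) := by
      refine intervalIntegral.integral_congr fun u _ => ?_
      rw [Real.log_mul hb0.ne' (Real.exp_pos _).ne', Real.log_exp]
      ring
    rw [e3, ← e, hc]; ring

/-- An assignment of workers and firms to critical teams exists. -/
theorem IsTypeDistribution.exists_isFeasible_criticalTeams (hμ : IsTypeDistribution μ f)
    (hpl : IsLowerCutoff μ pl)
    (hmono : MonotoneOn (fun x => x * f x) (Icc (quantile μ pl) (quantile μ (1 - 2 * pl))))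
    (hconc : ConcaveOn ℝ (Ioc 0 (1 / 3)) (logLoss μ)) :
    ∃ π, IsFeasible μ μ π ∧ π (criticalTeams fun x => -marginalProduct μ pl x)ᶜ = 0 := by
  have := hμ.prob
  have hM := hμ.matchingCurve hpl hconc
  obtain ⟨hpl0, hpl3⟩ := hpl.mem
  refine exists_coupling_of_integral_nonneg (isCompact_criticalTeams hM.continuousOn_g)
    (fun t ht => criticalTeams_rotate ht) fun α hα => ?_
  have hq : ∀ a b : ℝ, 0 ≤ a → a ≤ b → b ≤ 1 →
      IntervalIntegrable (fun p => α (quantile μ p)) volume a b := fun a b ha hab hb =>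
    (α.continuous.comp_continuousOn (hμ.continuousOn_quantile.mono
      fun p hp => ⟨ha.trans hp.1, hp.2.trans hb⟩)).intervalIntegrable_of_Icc hab
  have hq2 : IntervalIntegrable (fun p => α (quantile μ (1 - 2 * p))) volume 0 pl :=
    (α.continuous.comp_continuousOn (hμ.continuousOn_quantile.comp
      (f := fun p : ℝ => 1 - 2 * p) (by fun_prop) fun p hp =>
      ⟨by linarith [hp.2], by linarith [hp.1]⟩)).intervalIntegrable_of_Icc hpl0.le
  rw [hμ.integral_eq_quantile α.continuous,
    ← intervalIntegral.integral_add_adjacent_intervals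
      (hq 0 pl le_rfl hpl0.le (by linarith)) (hq pl 1 hpl0.le (by linarith) le_rfl),
    ← intervalIntegral.integral_add_adjacent_intervals
      (hq pl (1 - 2 * pl) hpl0.le (by linarith) (by linarith))
      (hq (1 - 2 * pl) 1 (by linarith) (by linarith) le_rfl)]
  have hmid := hμ.integral_middle_nonneg hpl hmono α.continuous fun x hx y hy z hz hxyz =>
    hα _ (hM.mid_mem_criticalTeams hx hy hz hxyz)
  have hsub := intervalIntegral.integral_comp_sub_mul (a := 0) (b := pl)
    (fun p => α (quantile μ p)) (two_ne_zero (α := ℝ)) 1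
  rw [mul_zero, sub_zero, smul_eq_mul] at hsub
  have hout : 0 ≤ ∫ p in (0 : ℝ)..pl,
      (α (quantile μ p) + 2 * α (quantile μ (1 - 2 * p))) := by
    refine intervalIntegral.integral_nonneg hpl0.le fun p hp => ?_
    have hp1 : p ∈ Icc (0 : ℝ) 1 := ⟨hp.1, by linarith [hp.2]⟩
    have h1 := hα _ (hM.low_mem_criticalTeams (x := quantile μ p)
      ⟨(hμ.quantile_mem hp1).1, hμ.quantile_mono hp.1 hp.2 (by linarith)⟩)
    simp only [hμ.cdf_quantile hp1] at h1
    linarith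
  rw [intervalIntegral.integral_add (hq 0 pl le_rfl hpl0.le (by linarith)) (hq2.const_mul 2),
    intervalIntegral.integral_const_mul] at hout
  linarith

/-! ### Equilibria -/

theorem IsTypeDistribution.integrable_of_continuousOn (hμ : IsTypeDistribution μ f) {φ : ℝ → ℝ}
    (hφ : ContinuousOn φ types) : Integrable φ μ := by
  have := hμ.prob
  have h : IntegrableOn φ (Icc 0 1) μ := hφ.integrableOn_compact isCompact_Icc
  rwa [IntegrableOn, Measure.restrict_eq_self_of_ae_mem
    (s := Icc (0 : ℝ) 1) hμ.measure_compl_Icc] at h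

/-- A closed set of full measure contains all types. -/
theorem IsTypeDistribution.types_subset_of_isClosed (hμ : IsTypeDistribution μ f) {P : Set ℝ}
    (hP : IsClosed P) (h : μ Pᶜ = 0) : types ⊆ P := by
  have := hμ.prob
  have hsub : Ioo (0 : ℝ) 1 ⊆ P := by
    intro x hx
    by_contra hxP
    have hnhds : Pᶜ ∩ Iio 1 ∈ nhds x :=
      Filter.inter_mem (hP.isOpen_compl.mem_nhds hxP) (Iio_mem_nhds hx.2)
    obtain ⟨l, hl, hly, hlsub⟩ : ∃ l, x < l ∧ l < 1 ∧ Icc x l ⊆ Pᶜ := by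
      obtain ⟨u, hu, husub⟩ := mem_nhdsGE_iff_exists_Icc_subset.1 (mem_nhdsWithin_of_mem_nhds hnhds)
      exact ⟨u, hu, (husub ⟨hu.le, le_rfl⟩).2, fun s hs => (husub hs).1⟩
    have h1 : μ (Ioc x l) = 0 := measure_mono_null (Ioc_subset_Icc_self.trans hlsub) h
    have h2 : μ (Ioc x l) = ENNReal.ofReal (cdf μ l - cdf μ x) := by
      conv_lhs => rw [← measure_cdf μ]
      exact (cdf μ).measure_Ioc x l
    have h3 := hμ.cdf_strictMono ⟨hx.1.le, hx.2.le⟩ ⟨hx.1.le.trans hl.le, hly.le⟩ hl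
    rw [h1] at h2
    exact absurd (ENNReal.ofReal_eq_zero.1 h2.symm) (not_le.2 (sub_pos.2 h3))
  have := closure_minimal hsub hP
  rwa [closure_Ioo zero_ne_one] at this

theorem IsFeasible.ae_mem (hμ : IsTypeDistribution μ f) {π : Measure (ℝ × ℝ × ℝ)}
    (hπ : IsFeasible μ μ π) :
    ∀ᵐ t ∂π, t.1 ∈ types ∧ t.2.1 ∈ types ∧ t.2.2 ∈ types := by
  have hae : ∀ᵐ x ∂μ, x ∈ types := hμ.measure_compl_Icc
  have h1 := hae
  have h2 := hae
  have h3 := hae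
  rw [← hπ.map_worker] at h1
  rw [← hπ.map_coworker] at h2
  rw [← hπ.map_firm] at h3
  filter_upwards [ae_of_ae_map (by fun_prop) h1, ae_of_ae_map (by fun_prop) h2,
    ae_of_ae_map (by fun_prop) h3] with t e1 e2 e3
  exact ⟨e1, e2, e3⟩

theorem IsFeasible.integrable_add (hμ : IsTypeDistribution μ f) {π : Measure (ℝ × ℝ × ℝ)}
    (hπ : IsFeasible μ μ π) {w v : ℝ → ℝ} (hw : ContinuousOn w types) (hv : ContinuousOn v types) :
    Integrable (fun t => w t.1 + w t.2.1 + v t.2.2) π ∧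
      ∫ t, (w t.1 + w t.2.1 + v t.2.2) ∂π
        = ∫ x, w x ∂μ + ∫ x, w x ∂μ + ∫ z, v z ∂μ := by
  have hwi := hμ.integrable_of_continuousOn hw
  have hvi := hμ.integrable_of_continuousOn hv
  have hw1 := hwi
  have hw2 := hwi
  rw [← hπ.map_worker] at hw1
  rw [← hπ.map_coworker] at hw2
  rw [← hπ.map_firm] at hvi
  have i1 : Integrable (fun t : ℝ × ℝ × ℝ => w t.1) π := hw1.comp_measurable (by fun_prop)
  have i2 : Integrable (fun t : ℝ × ℝ × ℝ => w t.2.1) π := hw2.comp_measurable (by fun_prop)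
  have i3 : Integrable (fun t : ℝ × ℝ × ℝ => v t.2.2) π := hvi.comp_measurable (by fun_prop)
  refine ⟨(i1.add i2).add i3, ?_⟩
  rw [integral_add (f := fun t : ℝ × ℝ × ℝ => w t.1 + w t.2.1) (i1.add i2) i3,
    integral_add i1 i2]
  have e1 : ∫ x, w x ∂μ = ∫ t, w t.1 ∂π := by
    conv_lhs => rw [← hπ.map_worker]
    exact integral_map (by fun_prop) hw1.aestronglyMeasurable
  have e2 : ∫ x, w x ∂μ = ∫ t, w t.2.1 ∂π := by
    conv_lhs => rw [← hπ.map_coworker]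
    exact integral_map (by fun_prop) hw2.aestronglyMeasurable
  have e3 : ∫ x, v x ∂μ = ∫ t, v t.2.2 ∂π := by
    conv_lhs => rw [← hπ.map_firm]
    exact integral_map (by fun_prop) hvi.aestronglyMeasurable
  rw [← e1, ← e2, ← e3]

theorem IsFeasible.integrable_output (hμ : IsTypeDistribution μ f) {π : Measure (ℝ × ℝ × ℝ)}
    (hπ : IsFeasible μ μ π) : Integrable (fun t => output t.1 t.2.1 t.2.2) π := by
  have := hπ.prob
  refine Integrable.of_bound (by unfold output; fun_prop) 1 ?_
  filter_upwards [hπ.ae_mem hμ] with t ⟨h1, h2, h3⟩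
  have h12 : t.1 * t.2.1 ∈ Icc (0 : ℝ) 1 :=
    ⟨mul_nonneg h1.1 h2.1, mul_le_one₀ h1.2 h2.1 h2.2⟩
  rw [output, Real.norm_eq_abs, abs_of_nonneg (mul_nonneg (sub_nonneg.2 h12.2) h3.1)]
  exact mul_le_one₀ (by linarith [h12.1]) h3.1 h3.2

/-- Weak duality. -/
theorem IsFeasible.integral_output_le (hμ : IsTypeDistribution μ f) {π : Measure (ℝ × ℝ × ℝ)}
    (hπ : IsFeasible μ μ π) {w v : ℝ → ℝ} (hw : ContinuousOn w types) (hv : ContinuousOn v types)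
    (hle : ∀ x ∈ types, ∀ y ∈ types, ∀ z ∈ types, output x y z ≤ w x + w y + v z) :
    ∫ t, output t.1 t.2.1 t.2.2 ∂π ≤ ∫ x, w x ∂μ + ∫ x, w x ∂μ + ∫ z, v z ∂μ := by
  obtain ⟨hi, he⟩ := hπ.integrable_add hμ hw hv
  rw [← he]
  refine integral_mono_ae (hπ.integrable_output hμ) hi ?_
  filter_upwards [hπ.ae_mem hμ] with t ⟨h1, h2, h3⟩
  exact hle _ h1 _ h2 _ h3

/-- A feasible assignment carried by `S` attains the dual bound given by potentials that are tight
on `S`. -/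
theorem IsFeasible.integral_output_eq (hμ : IsTypeDistribution μ f) {π : Measure (ℝ × ℝ × ℝ)}
    (hπ : IsFeasible μ μ π) {w v : ℝ → ℝ} (hw : ContinuousOn w types) (hv : ContinuousOn v types)
    {S : Set (ℝ × ℝ × ℝ)} (hS : π Sᶜ = 0)
    (heq : ∀ t ∈ S, output t.1 t.2.1 t.2.2 = w t.1 + w t.2.1 + v t.2.2) :
    ∫ t, output t.1 t.2.1 t.2.2 ∂π = ∫ x, w x ∂μ + ∫ x, w x ∂μ + ∫ z, v z ∂μ := by
  rw [← (hπ.integrable_add hμ hw hv).2]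
  refine integral_congr_ae ?_
  have : ∀ᵐ t ∂π, t ∈ S := hS
  filter_upwards [this] with t ht
  exact heq t ht

/-- Complementary slackness: dual feasible prices that are tight on critical teams form an
equilibrium with any feasible assignment to critical teams. -/
theorem isEquilibrium_of_tight (hμ : IsTypeDistribution μ f) {π : Measure (ℝ × ℝ × ℝ)}
    (hπ : IsFeasible μ μ π) {w v g : ℝ → ℝ} (hw : ContinuousOn w types) (hv : ContinuousOn v types)
    (hle : ∀ x ∈ types, ∀ y ∈ types, ∀ z ∈ types, output x y z ≤ w x + w y + v z)
    (hS : π (criticalTeams g)ᶜ = 0)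
    (heq : ∀ t ∈ criticalTeams g, output t.1 t.2.1 t.2.2 = w t.1 + w t.2.1 + v t.2.2)
    (hex : ∀ x ∈ types, ∃ y z, (x, y, z) ∈ criticalTeams g) :
    IsEquilibrium μ μ w v π := by
  refine ⟨hπ, fun z hz => ⟨?_, ?_⟩, fun x hx => ⟨?_, ?_⟩, fun y hy => ⟨?_, ?_⟩,
    hπ.integral_output_eq hμ hw hv hS heq⟩
  · obtain ⟨x, y, hxy⟩ := hex z hz
    have ht := criticalTeams_rotate hxy
    have := heq _ ht
    exact ⟨(x, y), ⟨ht.1.1, ht.1.2.1⟩, by simp only at this ⊢; linarith⟩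
  · rintro _ ⟨⟨x, y⟩, ⟨hx, hy⟩, rfl⟩
    have := hle x hx y hy z hz
    simp only; linarith
  · obtain ⟨y, z, ht⟩ := hex x hx
    have := heq _ ht
    exact ⟨(y, z), ⟨ht.1.2.1, ht.1.2.2⟩, by simp only at this ⊢; linarith⟩
  · rintro _ ⟨⟨y, z⟩, ⟨hy, hz⟩, rfl⟩
    have := hle x hx y hy z hz
    simp only; linarith
  · obtain ⟨z, x, hzx⟩ := hex y hy
    have ht := criticalTeams_rotate (criticalTeams_rotate hzx)
    have := heq _ ht
    exact ⟨(x, z), ⟨ht.1.1, ht.1.2.2⟩, by simp only at this ⊢; linarith⟩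
  · rintro _ ⟨⟨x, z⟩, ⟨hx, hz⟩, rfl⟩
    have := hle x hx y hy z hz
    simp only; linarith

/-- The firm values that go with the wages `k - ∫₀ˣ g`. -/
noncomputable def firmValue (g : ℝ → ℝ) (a b k z : ℝ) : ℝ :=
  z - (∫ s in (0 : ℝ)..z, g s) - 2 * k - slack g a b b

theorem output_eq_sub_slack {g w : ℝ → ℝ} {a b k x y z : ℝ}
    (hx : w x = k - ∫ s in (0 : ℝ)..x, g s) (hy : w y = k - ∫ s in (0 : ℝ)..y, g s) :
    output x y z = w x + w y + firmValue g a b k z - (slack g x y z - slack g a b b) := by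
  rw [hx, hy, output, firmValue]
  simp only [slack]; ring

theorem MatchingCurve.continuousOn_firmValue {a b : ℝ} {D U g : ℝ → ℝ}
    (h : MatchingCurve a b D U g) (k : ℝ) : ContinuousOn (firmValue g a b k) types :=
  ((continuousOn_id.sub (continuousOn_primitive_unit h.continuousOn_g)).sub
    continuousOn_const).sub continuousOn_const

theorem MatchingCurve.continuousOn_wage {a b k : ℝ} {D U g w : ℝ → ℝ}
    (h : MatchingCurve a b D U g) (hw : ∀ x ∈ types, w x = k - ∫ s in (0 : ℝ)..x, g s) :
    ContinuousOn w types :=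
  (continuousOn_const.sub (continuousOn_primitive_unit h.continuousOn_g)).congr hw

theorem MatchingCurve.output_le {a b k : ℝ} {D U g w : ℝ → ℝ} (h : MatchingCurve a b D U g)
    (hw : ∀ x ∈ types, w x = k - ∫ s in (0 : ℝ)..x, g s) :
    ∀ x ∈ types, ∀ y ∈ types, ∀ z ∈ types,
      output x y z ≤ w x + w y + firmValue g a b k z := fun x hx y hy z hz => by
  rw [output_eq_sub_slack (a := a) (b := b) (hw x hx) (hw y hy)]
  have := h.slack_ge hx hy hz
  linarith

theorem MatchingCurve.output_eq {a b k : ℝ} {D U g w : ℝ → ℝ} (h : MatchingCurve a b D U g)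
    (hw : ∀ x ∈ types, w x = k - ∫ s in (0 : ℝ)..x, g s) :
    ∀ t ∈ criticalTeams g,
      output t.1 t.2.1 t.2.2 = w t.1 + w t.2.1 + firmValue g a b k t.2.2 := fun t ht => by
  rw [output_eq_sub_slack (a := a) (b := b) (hw _ ht.1.1) (hw _ ht.1.2.1),
    h.slack_criticalTeams (x := t.1) (y := t.2.1) (z := t.2.2) ht]
  ring

section Uniqueness

variable {w v : ℝ → ℝ} {π : Measure (ℝ × ℝ × ℝ)}

theorem IsEquilibrium.output_le (h : IsEquilibrium μ μ w v π) :
    ∀ x ∈ types, ∀ y ∈ types, ∀ z ∈ types, output x y z ≤ w x + w y + v z :=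
  fun x hx y hy z hz => by
    have := (h.firm z hz).2 ⟨(x, y), ⟨hx, hy⟩, rfl⟩
    simp only at this; linarith

/-- Wages are Lipschitz, since output is Lipschitz in the skill of each worker. -/
theorem IsEquilibrium.continuousOn_wage (h : IsEquilibrium μ μ w v π) : ContinuousOn w types := by
  refine (LipschitzOnWith.of_le_add (s := types) fun x hx x' hx' => ?_).continuousOn
  obtain ⟨⟨y, z⟩, ⟨hy, hz⟩, he⟩ := (h.worker x hx).1
  have := h.output_le x' hx' y hy z hz
  simp only [output] at he this
  have hyz : y * z ∈ Icc (0 : ℝ) 1 := ⟨mul_nonneg hy.1 hz.1, mul_le_one₀ hy.2 hz.1 hz.2⟩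
  have h1 : w x - w x' ≤ (x' - x) * (y * z) := by linarith
  have h2 : (x' - x) * (y * z) ≤ |x - x'| := by
    rw [abs_sub_comm]
    exact (mul_le_mul_of_nonneg_right (le_abs_self _) hyz.1).trans
      (mul_le_of_le_one_right (abs_nonneg _) hyz.2)
  rw [Real.dist_eq]; linarith

theorem IsEquilibrium.continuousOn_value (h : IsEquilibrium μ μ w v π) :
    ContinuousOn v types := by
  refine (LipschitzOnWith.of_le_add (s := types) fun z hz z' hz' => ?_).continuousOn
  obtain ⟨⟨x, y⟩, ⟨hx, hy⟩, he⟩ := (h.firm z hz).1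
  have := h.output_le x hx y hy z' hz'
  simp only [output] at he this
  have hxy : x * y ∈ Icc (0 : ℝ) 1 := ⟨mul_nonneg hx.1 hy.1, mul_le_one₀ hx.2 hy.1 hy.2⟩
  have h1 : v z - v z' ≤ (z - z') * (1 - x * y) := by linarith
  have h2 : (z - z') * (1 - x * y) ≤ |z - z'| :=
    (mul_le_mul_of_nonneg_right (le_abs_self _) (by linarith [hxy.2])).trans
      (mul_le_of_le_one_right (abs_nonneg _) (by linarith [hxy.1]))
  rw [Real.dist_eq]; linarith

/-- In any equilibrium every type is paid for in some critical team: an optimal assignment `ρ` to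
critical teams has zero surplus slack almost surely, hence on a compact set whose projection is
closed and of full measure. -/
theorem IsEquilibrium.exists_tight_criticalTeam (hμ : IsTypeDistribution μ f)
    (h : IsEquilibrium μ μ w v π) {a b : ℝ} {D U g : ℝ → ℝ} (hM : MatchingCurve a b D U g)
    {ρ : Measure (ℝ × ℝ × ℝ)} (hρ : IsFeasible μ μ ρ) (hS : ρ (criticalTeams g)ᶜ = 0) {x : ℝ}
    (hx : x ∈ types) :
    ∃ y z, (x, y, z) ∈ criticalTeams g ∧ output x y z = w x + w y + v z := by
  have hw := h.continuousOn_wage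
  have hv := h.continuousOn_value
  obtain ⟨hi, he⟩ := hρ.integrable_add hμ hw hv
  have ho := hρ.integrable_output hμ
  -- `ρ` is optimal
  have hopt : ∫ t, output t.1 t.2.1 t.2.2 ∂π ≤ ∫ t, output t.1 t.2.1 t.2.2 ∂ρ := by
    set w₀ : ℝ → ℝ := fun x => 0 - ∫ s in (0 : ℝ)..x, g s with hw₀
    have hw₀' : ∀ x ∈ types, w₀ x = 0 - ∫ s in (0 : ℝ)..x, g s := fun _ _ => rfl
    rw [hρ.integral_output_eq hμ (hM.continuousOn_wage hw₀') (hM.continuousOn_firmValue 0) hS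
      (hM.output_eq hw₀')]
    exact h.feasible.integral_output_le hμ (hM.continuousOn_wage hw₀')
      (hM.continuousOn_firmValue 0) (hM.output_le hw₀')
  rw [h.resource, ← he] at hopt
  have hnn : 0 ≤ᵐ[ρ] fun t => (w t.1 + w t.2.1 + v t.2.2) - output t.1 t.2.1 t.2.2 := by
    filter_upwards [hρ.ae_mem hμ] with t ⟨h1, h2, h3⟩
    have := h.output_le _ h1 _ h2 _ h3
    simp only [Pi.zero_apply]; linarith
  have hzero : ∫ t, ((w t.1 + w t.2.1 + v t.2.2) - output t.1 t.2.1 t.2.2) ∂ρ = 0 := by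
    refine le_antisymm ?_ (integral_nonneg_of_ae hnn)
    rw [integral_sub hi ho]; linarith
  have hae := (integral_eq_zero_iff_of_nonneg_ae hnn (hi.sub ho)).1 hzero
  -- the compact set of tight critical teams
  set K : Set (ℝ × ℝ × ℝ) := criticalTeams g ∩
    (fun t => (w t.1 + w t.2.1 + v t.2.2) - output t.1 t.2.1 t.2.2) ⁻¹' {0} with hK
  have hSc := isCompact_criticalTeams hM.continuousOn_g
  have hcont : ContinuousOn
      (fun t : ℝ × ℝ × ℝ => (w t.1 + w t.2.1 + v t.2.2) - output t.1 t.2.1 t.2.2)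
      (criticalTeams g) := by
    refine (((hw.comp (f := fun t : ℝ × ℝ × ℝ => t.1) (by fun_prop) fun t ht => ht.1.1).add
      (hw.comp (f := fun t : ℝ × ℝ × ℝ => t.2.1) (by fun_prop) fun t ht => ht.1.2.1)).add
      (hv.comp (f := fun t : ℝ × ℝ × ℝ => t.2.2) (by fun_prop) fun t ht => ht.1.2.2)).sub ?_
    unfold output; fun_prop
  have hKc : IsCompact K := hSc.of_isClosed_subset
    (hcont.preimage_isClosed_of_isClosed hSc.isClosed isClosed_singleton) inter_subset_left
  have hKρ : ∀ᵐ t ∂ρ, t ∈ K := by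
    have : ∀ᵐ t ∂ρ, t ∈ criticalTeams g := hS
    filter_upwards [this, hae] with t h1 h2
    exact ⟨h1, h2⟩
  have hP : IsCompact ((fun t : ℝ × ℝ × ℝ => t.1) '' K) := hKc.image (by fun_prop)
  have hPμ : μ ((fun t : ℝ × ℝ × ℝ => t.1) '' K)ᶜ = 0 := by
    have : (ρ.map fun t => t.1) ((fun t : ℝ × ℝ × ℝ => t.1) '' K)ᶜ = 0 := by
      rw [Measure.map_apply (by fun_prop) hP.measurableSet.compl]
      exact measure_mono_null (fun t ht htK => ht ⟨t, htK, rfl⟩) hKρ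
    rwa [hρ.map_worker] at this
  obtain ⟨⟨x', y, z⟩, ⟨ht, h0⟩, rfl⟩ := hμ.types_subset_of_isClosed hP.isClosed hPμ hx
  refine ⟨y, z, ht, ?_⟩
  have h0' : (w x' + w y + v z) - output x' y z = 0 := h0
  simp only; linarith

/-- Equilibrium wages are a primitive of the marginal product `-g`: the critical team that pays `x`
exactly is available to any other type, so `-g x` is a subgradient of `w` at `x`. -/
theorem IsEquilibrium.wage_eq (hμ : IsTypeDistribution μ f) (h : IsEquilibrium μ μ w v π) {a b : ℝ}
    {D U g : ℝ → ℝ} (hM : MatchingCurve a b D U g) {ρ : Measure (ℝ × ℝ × ℝ)}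
    (hρ : IsFeasible μ μ ρ) (hS : ρ (criticalTeams g)ᶜ = 0) {x : ℝ} (hx : x ∈ types) :
    w x = w 0 - ∫ s in (0 : ℝ)..x, g s := by
  have hsub : ∀ x ∈ types, ∀ x' ∈ types, w x - (x' - x) * g x ≤ w x' := by
    intro x hx x' hx'
    obtain ⟨y, z, ht, he⟩ := h.exists_tight_criticalTeam hμ hM hρ hS hx
    have h1 := h.output_le x' hx' y ht.1.2.1 z ht.1.2.2
    have h2 : y * z = g x := ht.2.1
    simp only [output] at he h1
    rw [← h2]; linarith
  have hder : ∀ x ∈ types, HasDerivWithinAt w (-g x) types x := by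
    intro x hx
    refine hasDerivWithinAt_of_abs_sub_le (hM.continuousOn_g x hx) fun x' hx' => ?_
    have h1 := hsub x hx x' hx'
    have h2 := hsub x' hx' x hx
    rw [abs_of_nonneg (by linarith), ← abs_mul, ← abs_neg]
    exact le_trans (by linarith) (le_abs_self _)
  have hsum : ∀ x ∈ types,
      HasDerivWithinAt (fun y => w y + ∫ s in (0 : ℝ)..y, g s) 0 types x := fun x hx => by
    have := (hder x hx).fun_add (hasDerivWithinAt_primitive_unit hM.continuousOn_g hx)
    rwa [neg_add_cancel] at this
  have hconst := constant_of_derivWithin_zero (fun y hy => (hsum y hy).differentiableWithinAt)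
    (fun y hy => (hsum y (Ico_subset_Icc_self hy)).derivWithin
      (uniqueDiffOn_Icc zero_lt_one y (Ico_subset_Icc_self hy))) x hx
  simp only [intervalIntegral.integral_same, add_zero] at hconst
  linarith

end Uniqueness

end TeamSorting

theorem mainTheorem6 (μ : Measure ℝ) (f : ℝ → ℝ)
    (hμ : TeamSorting.IsTypeDistribution μ f)
    (pl : ℝ) (hpl : TeamSorting.IsLowerCutoff μ pl)
    (hmono : MonotoneOn (fun x => x * f x)
      (Icc (TeamSorting.quantile μ pl) (TeamSorting.quantile μ (1 - 2 * pl))))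
    (hconc : ConcaveOn ℝ (Ioc 0 (1 / 3)) (TeamSorting.logLoss μ)) :
    IntervalIntegrable (TeamSorting.marginalProduct μ pl) volume 0 1 ∧
    ∀ w : ℝ → ℝ, TeamSorting.IsEquilibriumWage μ μ w ↔
      ∃ Cw : ℝ, ∀ x ∈ Icc (0 : ℝ) 1,
        w x = Cw + ∫ s in (0 : ℝ)..x, TeamSorting.marginalProduct μ pl s := by
  have hM := hμ.matchingCurve hpl hconc
  obtain ⟨ρ, hρ, hS⟩ := hμ.exists_isFeasible_criticalTeams hpl hmono hconc
  have hneg : ∀ x : ℝ, ∫ s in (0 : ℝ)..x, TeamSorting.marginalProduct μ pl s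
      = -∫ s in (0 : ℝ)..x, -TeamSorting.marginalProduct μ pl s := fun x => by
    rw [intervalIntegral.integral_neg, neg_neg]
  refine ⟨?_, fun w => ⟨?_, ?_⟩⟩
  · have := (TeamSorting.intervalIntegrable_of_continuousOn_unit hM.continuousOn_g
      (x := 0) (y := 1) ⟨le_rfl, zero_le_one⟩ ⟨zero_le_one, le_rfl⟩).neg
    simpa only [Pi.neg_def, neg_neg] using this
  · rintro ⟨v, π, h⟩
    refine ⟨w 0, fun x hx => ?_⟩
    rw [h.wage_eq hμ hM hρ hS hx, hneg, sub_eq_add_neg]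
  · rintro ⟨k, hk⟩
    have hw : ∀ x ∈ TeamSorting.types,
        w x = k - ∫ s in (0 : ℝ)..x, -TeamSorting.marginalProduct μ pl s := fun x hx => by
      rw [hk x hx, hneg, sub_eq_add_neg]
    exact ⟨_, ρ, TeamSorting.isEquilibrium_of_tight hμ hρ (hM.continuousOn_wage hw)
      (hM.continuousOn_firmValue k) (hM.output_le hw) hS (hM.output_eq hw)
      fun x hx => hM.exists_criticalTeam hx⟩
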